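/- Let $n\ge 3$ and let $\bar e\in\mathbb S^{n-1}$. Let $L\subset\mathbb R^n$ be a convex body (a non-empty compact convex set) of revolution, that is, $\vartheta L=L$ for every rotation $\vartheta\in SO(n)$ with $\vartheta\bar e=\bar e$, and suppose that $L$ is not a single point. Let $h_L(u)=\max_{x\in L}\langle x,u\rangle$, $u\in\mathbb S^{n-1}$, be its support function, let $\square_n=\frac1{n-1}\Delta_{\mathbb S}+\mathrm{Id}$, where $\Delta_{\mathbb S}$ is the spherical Laplacian (applied to $h_L$ in the sense of distributions), and for a distribution $\nu$ on $\mathbb S^{n-1}$ let $a^n_k[\nu]=\langle P^n_k(\langle\bar e,\cdot\rangle),\nu\rangle$, where $P^n_k$ is the Legendre polynomial of dimension $n$ and degree $k$, normalized by $P^n_k(1)=1$; thus $$a^n_k[\square_n h_L]=\int_{\mathbb S^{n-1}}h_L(u)\,\square_n\big(P^n_k(\langle\bar e,\cdot\rangle)\big)(u)\,du .$$ Then $a^n_0[\square_n h_L]>0$ and $$-\frac1{n-1}\le\frac{a^n_2[\square_n h_L]}{a^n_0[\square_n h_L]}\le\frac1{(n-1)^2}.$$ Equality holds in the left hand inequality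 if and only if $L$ is a line segment, and in the right hand inequality if and only if $L$ is an $(n-1)$-dimensional disk (a closed ball of positive radius in a hyperplane). -/

import Mathlib

open scoped Manifold ContDiff InnerProductSpace

noncomputable section

namespace ConvexRevolution

/-- Euclidean space `ℝⁿ`. -/
abbrev E (n : ℕ) : Type := EuclideanSpace ℝ (Fin n)

/-- The unit sphere `S^{n-1}` of `ℝⁿ`. -/
abbrev S (n : ℕ) : Type := Metric.sphere (0 : E n) 1

/-- The dimension of `ℝⁿ` in the form in which the manifold structure of the sphere needs it. -/
instance factFinrank (n : ℕ) [NeZero n] : Fact (Module.finrank ℝ (E n) = (n - 1) + 1) :=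
  ⟨by rw [finrank_euclideanSpace_fin]; have := NeZero.pos n; omega⟩

/-- The space `C^∞(S^{n-1})` of smooth functions (test functions) on the sphere. -/
abbrev Test (n : ℕ) [NeZero n] : Type := C^∞⟮𝓡 (n - 1), S n; ℝ⟯

/-- The `0`-homogeneous extension `x ↦ φ(x/|x|)` of a function on the sphere
(with the irrelevant value `0` at the origin). -/
def homExt {n : ℕ} (φ : S n → ℝ) (x : E n) : ℝ :=
  open Classical in
  if hx : x ≠ 0 then φ ⟨‖x‖⁻¹ • x, by simp [norm_smul, hx]⟩ else 0

/-- The Laplace–Beltrami operator of the sphere: the value at `u` of the Laplacian in `ℝⁿ` of the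
`0`-homogeneous extension. -/
def sphLaplacian {n : ℕ} (φ : S n → ℝ) (u : S n) : ℝ :=
  Laplacian.laplacian (homExt φ) (u : E n)

theorem contDiffAt_homExt {n : ℕ} [NeZero n] (φ : Test n) {x : E n} (hx : x ≠ 0) :
    ContDiffAt ℝ ∞ (homExt φ) x := by
  let U : TopologicalSpace.Opens (E n) := ⟨{0}ᶜ, isOpen_compl_singleton⟩
  have hU : ∀ y : U, (y : E n) ≠ 0 := fun y => y.2
  have h1 : ContMDiff (𝓘(ℝ, E n)) (𝓘(ℝ, E n)) ∞ (fun y : U => ‖(y : E n)‖⁻¹ • (y : E n)) := by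
    intro y
    have h : ContMDiffAt (𝓘(ℝ, E n)) (𝓘(ℝ, E n)) ∞ (fun y : E n => ‖y‖⁻¹ • y) (y : E n) := by
      rw [contMDiffAt_iff_contDiffAt]
      exact ((contDiffAt_norm ℝ (hU y)).inv (norm_ne_zero_iff.2 (hU y))).smul contDiffAt_id
    exact contMDiffAt_subtype_iff.2 h
  have h2 : ∀ y : U, ‖(y : E n)‖⁻¹ • (y : E n) ∈ Metric.sphere (0 : E n) 1 := by
    intro y; simp [norm_smul, hU y]
  have h3 := φ.contMDiff.comp (h1.codRestrict_sphere h2)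
  have h4 := h3 ⟨x, hx⟩
  rw [← contMDiffAt_iff_contDiffAt]
  refine (contMDiffAt_subtype_iff (U := U) (x := ⟨x, hx⟩)).1 (h4.congr_of_eventuallyEq ?_)
  refine Filter.Eventually.of_forall fun y => ?_
  simp [homExt, hU y, Set.codRestrict]

theorem contMDiff_sphLaplacian {n : ℕ} [NeZero n] (φ : Test n) :
    ContMDiff (𝓡 (n - 1)) 𝓘(ℝ, ℝ) ∞ (sphLaplacian φ) := by
  have key : ∀ x : E n, x ≠ 0 → ContDiffAt ℝ ∞ (Laplacian.laplacian (homExt φ)) x := by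
    intro x hx
    rw [InnerProductSpace.laplacian_eq_iteratedFDeriv_stdOrthonormalBasis]
    refine ContDiffAt.sum fun i _ => ?_
    have h := (contDiffAt_homExt φ hx).iteratedFDeriv_right (m := ∞) (i := 2) (by rfl)
    exact (ContinuousMultilinearMap.apply ℝ (fun _ : Fin 2 => E n) ℝ _).contDiff.contDiffAt.comp x h
  intro u
  have hu : (u : E n) ≠ 0 := ne_zero_of_mem_unit_sphere u
  exact (key u hu).contMDiffAt.comp u (contMDiff_coe_sphere (n := n - 1) u)

theorem homExt_add {n : ℕ} (φ ψ : S n → ℝ) : homExt (φ + ψ) = homExt φ + homExt ψ := by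
  ext x; by_cases hx : x = 0 <;> simp [homExt, hx]

theorem homExt_smul {n : ℕ} (c : ℝ) (φ : S n → ℝ) : homExt (c • φ) = c • homExt φ := by
  ext x; by_cases hx : x = 0 <;> simp [homExt, hx]

/-- The Laplace–Beltrami operator as a linear operator on `C^∞(S^{n-1})`. -/
def laplace (n : ℕ) [NeZero n] : Test n →ₗ[ℝ] Test n where
  toFun φ := ⟨sphLaplacian φ, contMDiff_sphLaplacian φ⟩
  map_add' φ ψ := by
    ext u
    have hu : (u : E n) ≠ 0 := ne_zero_of_mem_unit_sphere u
    have h2 : (2 : WithTop ℕ∞) ≤ ∞ := WithTop.coe_le_coe.2 (le_top : (2 : ℕ∞) ≤ ⊤)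
    change sphLaplacian (⇑φ + ⇑ψ) u = sphLaplacian φ u + sphLaplacian ψ u
    rw [sphLaplacian, homExt_add]
    exact ((contDiffAt_homExt φ hu).of_le h2).laplacian_add ((contDiffAt_homExt ψ hu).of_le h2)
  map_smul' c φ := by
    ext u
    have hu : (u : E n) ≠ 0 := ne_zero_of_mem_unit_sphere u
    have h2 : (2 : WithTop ℕ∞) ≤ ∞ := WithTop.coe_le_coe.2 (le_top : (2 : ℕ∞) ≤ ⊤)
    change sphLaplacian (c • ⇑φ) u = c • sphLaplacian φ u
    rw [sphLaplacian, homExt_smul]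
    exact InnerProductSpace.laplacian_smul c ((contDiffAt_homExt φ hu).of_le h2)

/-- The box operator `□ₙ = (n-1)⁻¹ Δ_S + Id` on `C^∞(S^{n-1})`. -/
def box (n : ℕ) [NeZero n] : Test n →ₗ[ℝ] Test n :=
  ((n : ℝ) - 1)⁻¹ • laplace n + LinearMap.id

/-- Linear functionals on `C^∞(S^{n-1})`; these contain the distributions on the sphere. -/
abbrev TestDual (n : ℕ) [NeZero n] : Type := Test n →ₗ[ℝ] ℝ

/-- A continuous function `f` on the sphere, regarded as the distribution `φ ↦ ∫ f φ dσ`, where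
`σ` is the (unnormalized) surface area measure of the sphere. -/
def toDual {n : ℕ} [NeZero n] (f : C(S n, ℝ)) : TestDual n where
  toFun φ := ∫ u : S n, f u * φ u ∂((MeasureTheory.volume : MeasureTheory.Measure (E n)).toSphere)
  map_add' φ ψ := by
    have hi : ∀ χ : Test n, MeasureTheory.Integrable (fun u : S n => f u * χ u)
        ((MeasureTheory.volume : MeasureTheory.Measure (E n)).toSphere) := fun χ =>
      (f.continuous.mul χ.contMDiff.continuous).integrable_of_hasCompactSupport
        (HasCompactSupport.of_compactSpace _)
    rw [← MeasureTheory.integral_add (hi φ) (hi ψ)]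
    refine MeasureTheory.integral_congr_ae (Filter.Eventually.of_forall fun u => ?_)
    exact mul_add _ _ _
  map_smul' c φ := by
    rw [RingHom.id_apply, smul_eq_mul, ← MeasureTheory.integral_const_mul]
    refine MeasureTheory.integral_congr_ae (Filter.Eventually.of_forall fun u => ?_)
    exact mul_left_comm _ _ _

/-- The box operator on distributions, defined by duality: `⟨φ, □ₙν⟩ = ⟨□ₙφ, ν⟩`. -/
def boxDual {n : ℕ} [NeZero n] (ν : TestDual n) : TestDual n := ν.comp (box n)

/-- The Legendre polynomial `P^n_k` of dimension `n` and degree `k` (normalized by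
`P^n_k(1) = 1`), through its three-term recurrence. -/
def legendre (n : ℕ) : ℕ → Polynomial ℝ
  | 0 => 1
  | 1 => Polynomial.X
  | k + 2 => Polynomial.C ((k : ℝ) + n - 1)⁻¹ *
      (Polynomial.C (2 * (k : ℝ) + n) * Polynomial.X * legendre n (k + 1)
        - Polynomial.C ((k : ℝ) + 1) * legendre n k)

/-- The zonal spherical harmonic `u ↦ P^n_k(⟨e, u⟩)`. -/
def zonalLegendre {n : ℕ} [NeZero n] (e : S n) (k : ℕ) : Test n :=
  ⟨fun u => (legendre n k).eval ⟪(e : E n), (u : E n)⟫_ℝ, by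
    have h : ContDiff ℝ ∞ (fun x : E n => (legendre n k).eval ⟪(e : E n), x⟫_ℝ) :=
      ((legendre n k).contDiff_aeval ∞).comp (contDiff_const.inner ℝ contDiff_id)
    exact h.contMDiff.comp (contMDiff_coe_sphere (n := n - 1))⟩

/-- The coefficient `a^n_k[ν] = ⟨P^n_k(⟨e, ·⟩), ν⟩` with respect to the pole `e`. -/
def multiplier {n : ℕ} [NeZero n] (e : S n) (k : ℕ) (ν : TestDual n) : ℝ :=
  ν (zonalLegendre e k)

/-- The support function `h_L(u) = max {⟨x, u⟩ : x ∈ L}` on the sphere. -/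
def supportFn {n : ℕ} (L : ConvexBody (E n)) : C(S n, ℝ) :=
  ⟨fun u => sSup ((fun x : E n => ⟪x, (u : E n)⟫_ℝ) '' (L : Set (E n))),
    L.isCompact.continuous_sSup (f := fun (u : S n) (x : E n) => ⟪x, (u : E n)⟫_ℝ)
      (by
        change Continuous fun p : S n × E n => ⟪p.2, (p.1 : E n)⟫_ℝ
        fun_prop)⟩

/-- `L` is a body of revolution with axis `ℝe`: it is invariant under all rotations in `SO(n)`
that fix `e`. -/
def IsBodyOfRevolution {n : ℕ} (e : S n) (L : ConvexBody (E n)) : Prop :=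
  ∀ θ : E n ≃ₗᵢ[ℝ] E n, LinearMap.det (θ.toLinearEquiv : E n →ₗ[ℝ] E n) = 1 →
    θ (e : E n) = e → θ '' (L : Set (E n)) = L

/-- `A` is a (non-degenerate) line segment. -/
def IsLineSegment {n : ℕ} (A : Set (E n)) : Prop :=
  ∃ x y : E n, x ≠ y ∧ A = segment ℝ x y

/-- `A` is an `(n-1)`-dimensional disk: the closed ball of positive radius `r` and center `c`
within the hyperplane through `c` with unit normal `ν`. -/
def IsDisk {n : ℕ} (A : Set (E n)) : Prop :=
  ∃ (c : E n) (ν : S n) (r : ℝ), 0 < r ∧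
    A = {x : E n | ⟪x - c, (ν : E n)⟫_ℝ = 0 ∧ ‖x - c‖ ≤ r}

end ConvexRevolution

end

/-!
Since `P^n_0` and `P^n_2` are even eigenfunctions of `□_n`, both coefficients are integrals of the
width `w(u) = h_L(u) + h_L(-u)` against polynomials in `t = ⟪e, u⟫`, and the two inequalities say
that `∫ w (1 - (n + 1) t² / 2)` and `∫ w ((n + 1) t² - 1)` are nonnegative.

The width is a seminorm which depends only on `|t|` and on the distance `s` from the axis, and by
convexity it is monotone in each of the two. Let `z` be a point of height `t = 1` on the cone where
the weight changes sign. The multiple `w(z) |t|` of the width of a segment agrees with `w` on this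
cone, and monotonicity of `w` gives `(w - w(z) |t|) (1 - (n + 1) t² / 2) ≥ 0`; the multiple
`w(z) s / s(z)` of the width of a disk plays the same role for the other weight. By the divergence
theorem `|t|` and `s` are orthogonal to the respective weights, and the inequalities follow.
Equality forces `w` to agree with the comparison function, so `w` vanishes on the orthogonal
complement of the axis (`L` is a segment) or on the axis (`L` is a disk).
-/

noncomputable section

namespace ConvexRevolution

open MeasureTheory Metric Set

section SphereIntegration

/-- `f` is positively homogeneous of degree `k`. Including `r = 0` makes `f 0 = 0` for `k ≠ 0`. -/
def IsPosHomogeneous {V : Type*} [SMul ℝ V] (k : ℕ) (f : V → ℝ) : Prop :=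
  ∀ r : ℝ, 0 ≤ r → ∀ x, f (r • x) = r ^ k * f x

theorem IsPosHomogeneous.mul {V : Type*} [SMul ℝ V] {k l : ℕ} {f g : V → ℝ}
    (hf : IsPosHomogeneous k f) (hg : IsPosHomogeneous l g) :
    IsPosHomogeneous (k + l) fun x => f x * g x := by
  intro r hr x
  simp only [hf r hr, hg r hr, pow_add]
  ring

theorem IsPosHomogeneous.const_mul {V : Type*} [SMul ℝ V] {k : ℕ} {f : V → ℝ}
    (hf : IsPosHomogeneous k f) (c : ℝ) : IsPosHomogeneous k fun x => c * f x := by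
  intro r hr x
  simp only [hf r hr, mul_left_comm]

/-- The radial moment `∫₀^∞ r^q e^{-r²} dr`, which relates Gaussian integrals to spherical ones. -/
def radialMoment (q : ℕ) : ℝ := ∫ r in Ioi (0 : ℝ), r ^ q * Real.exp (-r ^ 2)

theorem radialMoment_eq_Gamma (q : ℕ) :
    radialMoment q = 1 / 2 * Real.Gamma (((q : ℝ) + 1) / 2) := by
  rw [radialMoment, ← integral_rpow_mul_exp_neg_rpow (p := 2) (q := q) two_pos
    (by linarith [q.cast_nonneg (α := ℝ)])]
  simp only [Real.rpow_natCast, Real.rpow_ofNat]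

theorem radialMoment_pos (q : ℕ) : 0 < radialMoment q := by
  rw [radialMoment_eq_Gamma]
  exact mul_pos one_half_pos (Real.Gamma_pos_of_pos (by positivity))

theorem radialMoment_add_two (q : ℕ) :
    radialMoment (q + 2) = ((q : ℝ) + 1) / 2 * radialMoment q := by
  rw [radialMoment_eq_Gamma, radialMoment_eq_Gamma,
    show (((q + 2 : ℕ) : ℝ) + 1) / 2 = ((q : ℝ) + 1) / 2 + 1 by push_cast; ring,
    Real.Gamma_add_one (by positivity)]
  ring

theorem integrableOn_pow_mul_exp_neg_sq (q : ℕ) :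
    IntegrableOn (fun r : ℝ => r ^ q * Real.exp (-r ^ 2)) (Ioi 0) := by
  simpa using integrableOn_rpow_mul_exp_neg_mul_sq (b := 1) one_pos (s := q)
    (by linarith [q.cast_nonneg (α := ℝ)])

section Normed

variable {V : Type*} [NormedAddCommGroup V] [NormedSpace ℝ V]

theorem IsPosHomogeneous.exists_abs_le_mul_norm_pow [FiniteDimensional ℝ V] {k : ℕ} {f : V → ℝ}
    (hf : IsPosHomogeneous k f) (hfc : Continuous f) : ∃ C, ∀ x ≠ 0, |f x| ≤ C * ‖x‖ ^ k := by
  obtain ⟨C, hC⟩ := (isCompact_sphere (0 : V) 1).exists_bound_of_continuousOn hfc.continuousOn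
  refine ⟨C, fun x hx => ?_⟩
  have hx' : ‖x‖ ≠ 0 := norm_ne_zero_iff.2 hx
  have hfx : f x = ‖x‖ ^ k * f (‖x‖⁻¹ • x) := by
    rw [← hf _ (norm_nonneg x), smul_inv_smul₀ hx']
  rw [hfx, abs_mul, abs_of_nonneg (by positivity), mul_comm]
  exact mul_le_mul_of_nonneg_right (hC _ (by simp [norm_smul, hx'])) (by positivity)

variable [FiniteDimensional ℝ V] [MeasurableSpace V] [BorelSpace V]
variable (μ : Measure V) [μ.IsAddHaarMeasure]

open scoped Pointwise in
theorem measurePreserving_neg_toSphere :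
    MeasurePreserving (Neg.neg : sphere (0 : V) 1 → _) μ.toSphere μ.toSphere := by
  refine ⟨continuous_neg.measurable, Measure.ext fun A hA => ?_⟩
  have hval : ((↑) '' (-A) : Set V) = -((↑) '' A) := by
    simp only [← image_neg_eq_neg, image_image, coe_neg_sphere]
  rw [Measure.map_apply continuous_neg.measurable hA, neg_preimage, μ.toSphere_apply' hA,
    μ.toSphere_apply' hA.neg, hval, Set.smul_neg, Measure.measure_neg]

theorem integral_comp_neg_toSphere (f : sphere (0 : V) 1 → ℝ) :
    ∫ u, f (-u) ∂μ.toSphere = ∫ u, f u ∂μ.toSphere :=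
  (measurePreserving_neg_toSphere μ).integral_comp (Homeomorph.neg _).measurableEmbedding f

variable [Nontrivial V]

theorem integral_mul_comp_norm_eq {k : ℕ} {f : V → ℝ} (hf : IsPosHomogeneous k f) (φ : ℝ → ℝ) :
    ∫ x, f x * φ ‖x‖ ∂μ = (∫ u : sphere (0 : V) 1, f u ∂μ.toSphere) *
      ∫ r in Ioi (0 : ℝ), r ^ (Module.finrank ℝ V - 1 + k) * φ r := by
  calc
    ∫ x, f x * φ ‖x‖ ∂μ = ∫ x : ({0}ᶜ : Set V), f x * φ ‖(x : V)‖ ∂(μ.comap (↑)) := by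
      rw [integral_subtype_comap (measurableSet_singleton _).compl fun x : V => f x * φ ‖x‖,
        restrict_compl_singleton]
    _ = ∫ z : sphere (0 : V) 1 × Ioi (0 : ℝ), f z.1 * ((z.2 : ℝ) ^ k * φ z.2)
          ∂μ.toSphere.prod (.volumeIoiPow (Module.finrank ℝ V - 1)) := by
      rw [← μ.measurePreserving_homeomorphUnitSphereProd.integral_comp
        (Homeomorph.measurableEmbedding _)]
      congr! 2 with x
      have hfx := hf ‖(x : V)‖ (norm_nonneg _) (‖(x : V)‖⁻¹ • x)
      rw [smul_inv_smul₀ (norm_ne_zero_iff.2 x.2)] at hfx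
      simp only [homeomorphUnitSphereProd_apply_snd_coe, homeomorphUnitSphereProd_apply_fst_coe,
        hfx]
      ring
    _ = (∫ u : sphere (0 : V) 1, f u ∂μ.toSphere) *
          ∫ r : Ioi (0 : ℝ), (r : ℝ) ^ k * φ r ∂.volumeIoiPow (Module.finrank ℝ V - 1) :=
      integral_prod_mul (fun u : sphere (0 : V) 1 => f u)
        fun r : Ioi (0 : ℝ) => (r : ℝ) ^ k * φ r
    _ = _ := by
      congr 1
      simp only [Measure.volumeIoiPow, ENNReal.ofReal]
      rw [integral_withDensity_eq_integral_smul (by fun_prop),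
        integral_subtype_comap measurableSet_Ioi fun r : ℝ =>
          Real.toNNReal (r ^ (Module.finrank ℝ V - 1)) • (r ^ k * φ r)]
      refine setIntegral_congr_fun measurableSet_Ioi fun r hr => ?_
      rw [NNReal.smul_def, Real.coe_toNNReal _ (pow_nonneg hr.out.le _), smul_eq_mul, pow_add,
        mul_assoc]

theorem IsPosHomogeneous.integrable_mul_gaussian {k : ℕ} {f : V → ℝ} (hf : IsPosHomogeneous k f)
    (hfc : Continuous f) : Integrable (fun x => f x * Real.exp (-‖x‖ ^ 2)) μ := by
  obtain ⟨C, hC⟩ := hf.exists_abs_le_mul_norm_pow hfc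
  have hnorm : Integrable (fun x : V => ‖x‖ ^ k * Real.exp (-‖x‖ ^ 2)) μ := by
    rw [integrable_fun_norm_addHaar μ (f := fun r : ℝ => r ^ k * Real.exp (-r ^ 2))]
    simpa only [smul_eq_mul, pow_add, mul_assoc] using
      integrableOn_pow_mul_exp_neg_sq (Module.finrank ℝ V - 1 + k)
  refine (hnorm.const_mul C).mono' (by fun_prop) ?_
  filter_upwards [Measure.ae_ne μ 0] with x hx
  rw [norm_mul, Real.norm_eq_abs, Real.norm_eq_abs, Real.abs_exp, ← mul_assoc]
  gcongr
  exact hC x hx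

end Normed

section Inner

variable {V : Type*} [NormedAddCommGroup V] [InnerProductSpace ℝ V]

theorem isPosHomogeneous_inner (v : V) : IsPosHomogeneous 1 fun x => ⟪v, x⟫_ℝ := by
  intro r _ x
  simp only [inner_smul_right, pow_one]

theorem hasLineDerivAt_exp_neg_norm_sq (x v : V) :
    HasLineDerivAt ℝ (fun x : V => Real.exp (-‖x‖ ^ 2))
      (-(2 * ⟪v, x⟫_ℝ) * Real.exp (-‖x‖ ^ 2)) x v := by
  have h := ((hasStrictFDerivAt_norm_sq x).hasFDerivAt.neg.exp).hasLineDerivAt v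
  simpa [real_inner_comm, mul_comm] using h

variable [FiniteDimensional ℝ V] [Nontrivial V] [MeasurableSpace V] [BorelSpace V]

theorem integral_hasLineDerivAt_mul_gaussian (μ : Measure V) [μ.IsAddHaarMeasure] {k : ℕ}
    {f f' : V → ℝ} {v : V} (hf : IsPosHomogeneous (k + 1) f) (hfc : Continuous f)
    (hf' : IsPosHomogeneous k f') (hfc' : Continuous f')
    (hderiv : ∀ x, HasLineDerivAt ℝ f (f' x) x v) :
    ∫ x, f' x * Real.exp (-‖x‖ ^ 2) ∂μ =
      2 * ∫ x, ⟪v, x⟫_ℝ * f x * Real.exp (-‖x‖ ^ 2) ∂μ := by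
  have hvf := ((isPosHomogeneous_inner v).mul hf).integrable_mul_gaussian μ (by fun_prop)
  have h := integral_bilinear_hasLineDerivAt_right_eq_neg_left_of_integrable
    (μ := μ) (B := ContinuousLinearMap.mul ℝ ℝ) (f := f) (f' := f') (v := v)
    (g := fun x => Real.exp (-‖x‖ ^ 2)) (g' := fun x => -(2 * ⟪v, x⟫_ℝ) * Real.exp (-‖x‖ ^ 2))
    (hf'.integrable_mul_gaussian μ hfc')
    ((hvf.const_mul (-2)).congr
      (.of_forall fun x => by simp only [ContinuousLinearMap.mul_apply']; ring))
    (hf.integrable_mul_gaussian μ hfc)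
    (fun x _ => hderiv x) (fun x _ => hasLineDerivAt_exp_neg_norm_sq x v)
  simp only [ContinuousLinearMap.mul_apply'] at h
  rw [← neg_eq_iff_eq_neg.2 h, ← integral_neg, ← integral_const_mul]
  congr! 2
  ring

/-- The divergence theorem on the sphere for the field `f v`, obtained by integrating by parts
against a Gaussian. -/
theorem integral_toSphere_hasLineDerivAt (μ : Measure V) [μ.IsAddHaarMeasure] {k : ℕ}
    {f f' : V → ℝ} {v : V} (hf : IsPosHomogeneous (k + 1) f) (hfc : Continuous f)
    (hf' : IsPosHomogeneous k f') (hfc' : Continuous f')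
    (hderiv : ∀ x, HasLineDerivAt ℝ f (f' x) x v) :
    ∫ u : sphere (0 : V) 1, f' u ∂μ.toSphere =
      (Module.finrank ℝ V + k : ℝ) *
        ∫ u : sphere (0 : V) 1, ⟪v, (u : V)⟫_ℝ * f u ∂μ.toSphere := by
  have hvf := (isPosHomogeneous_inner v).mul hf
  rw [show 1 + (k + 1) = k + 2 by ring] at hvf
  have hparts := integral_hasLineDerivAt_mul_gaussian μ hf hfc hf' hfc' hderiv
  have hdim : 1 ≤ Module.finrank ℝ V := Module.finrank_pos
  rw [integral_mul_comp_norm_eq μ hf' fun r => Real.exp (-r ^ 2),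
    integral_mul_comp_norm_eq μ hvf fun r => Real.exp (-r ^ 2)] at hparts
  change _ * radialMoment _ = 2 * (_ * radialMoment (_ + _ + 2)) at hparts
  rw [radialMoment_add_two, Nat.cast_add, Nat.cast_sub hdim] at hparts
  refine mul_right_cancel₀ (radialMoment_pos (Module.finrank ℝ V - 1 + k)).ne' ?_
  rw [hparts]
  push_cast
  ring

theorem integral_toSphere_divergence_eq_zero (μ : Measure V) [μ.IsAddHaarMeasure] {k : ℕ}
    {f f' : V → ℝ} {v : V} (hf : IsPosHomogeneous (k + 1) f) (hfc : Continuous f)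
    (hf' : IsPosHomogeneous k f') (hfc' : Continuous f')
    (hderiv : ∀ x, HasLineDerivAt ℝ f (f' x) x v) :
    ∫ u : sphere (0 : V) 1,
      ((Module.finrank ℝ V + k) * (⟪v, (u : V)⟫_ℝ * f u) - f' u) ∂μ.toSphere = 0 := by
  have hint : ∀ g : sphere (0 : V) 1 → ℝ, Continuous g → Integrable g μ.toSphere := fun g hg =>
    hg.integrable_of_hasCompactSupport (.of_compactSpace g)
  rw [integral_sub (hint _ (by fun_prop)) (hint _ (by fun_prop)), integral_const_mul,
    integral_toSphere_hasLineDerivAt μ hf hfc hf' hfc' hderiv, sub_self]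

end Inner

end SphereIntegration

section ComparisonPrinciple

variable {X : Type*} [TopologicalSpace X] [CompactSpace X] [MeasurableSpace X] [BorelSpace X]
  (ν : Measure X) [IsFiniteMeasure ν] [ν.IsOpenPosMeasure]

theorem integral_mul_nonneg_and_eq_zero_iff {f k g : X → ℝ} (hf : Continuous f) (hk : Continuous k)
    (hg : Continuous g) (hkg : ∫ x, k x * g x ∂ν = 0) (hfk : ∀ x, 0 ≤ (f x - k x) * g x) :
    0 ≤ ∫ x, f x * g x ∂ν ∧ (∫ x, f x * g x ∂ν = 0 ↔ ∀ x, (f x - k x) * g x = 0) := by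
  have hint : ∀ h : X → ℝ, Continuous h → Integrable h ν := fun h hh =>
    hh.integrable_of_hasCompactSupport (.of_compactSpace h)
  have hdiff : ∫ x, f x * g x ∂ν = ∫ x, (f x - k x) * g x ∂ν := by
    have h := integral_sub (hint _ (hf.mul hg)) (hint _ (hk.mul hg))
    simp only [Pi.mul_apply, hkg, sub_zero] at h
    simp only [sub_mul, h]
  have hcont : Continuous fun x => (f x - k x) * g x := by fun_prop
  rw [hdiff]
  refine ⟨integral_nonneg hfk, ?_⟩
  rw [integral_eq_zero_iff_of_nonneg hfk (hint _ hcont), hcont.ae_eq_iff_eq ν continuous_zero,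
    funext_iff]
  rfl

end ComparisonPrinciple

section AxialSymmetry

variable {V : Type*} [NormedAddCommGroup V] [InnerProductSpace ℝ V]

theorem exists_norm_eq_one_forall_inner_eq_zero (s : Finset V)
    (hs : s.card < Module.finrank ℝ V) : ∃ w : V, ‖w‖ = 1 ∧ ∀ v ∈ s, ⟪v, w⟫_ℝ = 0 := by
  have : FiniteDimensional ℝ V := Module.finite_of_finrank_pos (Nat.zero_lt_of_lt hs)
  have hspan : Submodule.span ℝ (s : Set V) ≠ ⊤ := fun h => by
    have hcard : Module.finrank ℝ (Submodule.span ℝ (s : Set V)) ≤ s.card :=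
      finrank_span_finset_le_card s
    rw [h, finrank_top] at hcard
    exact hcard.not_gt hs
  obtain ⟨v, hv, hv0⟩ := Submodule.exists_mem_ne_zero_of_ne_bot
    (mt Submodule.orthogonal_eq_bot_iff.1 hspan)
  refine ⟨‖v‖⁻¹ • v, norm_smul_inv_norm hv0, fun x hx => ?_⟩
  rw [inner_smul_right, (Submodule.mem_orthogonal _ v).1 hv x (Submodule.subset_span hx), mul_zero]

/-- The distance of `x` from the axis `ℝe`, for a unit vector `e`. Together with `⟪e, x⟫` it gives
the cylindrical coordinates of `x`. -/
def axisDist (e x : V) : ℝ := ‖x - ⟪e, x⟫_ℝ • e‖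

theorem axisDist_nonneg (e x : V) : 0 ≤ axisDist e x := norm_nonneg _

@[fun_prop]
theorem continuous_axisDist (e : V) : Continuous (axisDist e) := by
  unfold axisDist
  fun_prop

theorem axisDist_smul (e : V) (r : ℝ) (x : V) : axisDist e (r • x) = |r| * axisDist e x := by
  rw [axisDist, axisDist, inner_smul_right, mul_smul, ← smul_sub, norm_smul, Real.norm_eq_abs]

theorem isPosHomogeneous_axisDist (e : V) : IsPosHomogeneous 1 (axisDist e) := by
  intro r hr x
  rw [axisDist_smul, abs_of_nonneg hr, pow_one]

theorem axisDist_of_inner_eq_zero {e v : V} (hv : ⟪e, v⟫_ℝ = 0) : axisDist e v = ‖v‖ := by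
  rw [axisDist, hv, zero_smul, sub_zero]

section UnitAxis

variable {e : V} (he : ‖e‖ = 1)
include he

theorem inner_sub_inner_smul (x : V) : ⟪e, x - ⟪e, x⟫_ℝ • e⟫_ℝ = 0 := by
  rw [inner_sub_right, inner_smul_right, inner_self_eq_one_of_norm_eq_one he, mul_one, sub_self]

theorem axisDist_add_smul (x : V) (t : ℝ) : axisDist e (x + t • e) = axisDist e x := by
  rw [axisDist, axisDist, inner_add_right, inner_smul_right, inner_self_eq_one_of_norm_eq_one he,
    mul_one, add_smul, add_sub_add_right_eq_sub]

theorem axisDist_self : axisDist e e = 0 := by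
  rw [axisDist, inner_self_eq_one_of_norm_eq_one he, one_smul, sub_self, norm_zero]

theorem axisDist_sq (x : V) : axisDist e x ^ 2 = ‖x‖ ^ 2 - ⟪e, x⟫_ℝ ^ 2 := by
  rw [axisDist, norm_sub_sq_real, norm_smul, he, inner_smul_right, real_inner_comm, mul_one,
    Real.norm_eq_abs, sq_abs]
  ring

theorem inner_smul_add_smul_axis {w : V} (hew : ⟪e, w⟫_ℝ = 0) (s t : ℝ) :
    ⟪e, s • w + t • e⟫_ℝ = t := by
  rw [inner_add_right, inner_smul_right, inner_smul_right, hew,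
    inner_self_eq_one_of_norm_eq_one he, mul_zero, zero_add, mul_one]

theorem axisDist_smul_add_smul_axis {w : V} (hw : ‖w‖ = 1) (hew : ⟪e, w⟫_ℝ = 0) (s t : ℝ) :
    axisDist e (s • w + t • e) = |s| := by
  rw [axisDist_add_smul he, axisDist_smul, axisDist_of_inner_eq_zero hew, hw, mul_one]

theorem exists_inner_eq_axisDist_eq (hV : 1 < Module.finrank ℝ V) (t : ℝ) {s : ℝ} (hs : 0 ≤ s) :
    ∃ x : V, ⟪e, x⟫_ℝ = t ∧ axisDist e x = s := by
  obtain ⟨w, hw, hew⟩ := exists_norm_eq_one_forall_inner_eq_zero {e} (by simpa using hV)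
  replace hew : ⟪e, w⟫_ℝ = 0 := hew e (Finset.mem_singleton_self e)
  exact ⟨s • w + t • e, inner_smul_add_smul_axis he hew s t,
    (axisDist_smul_add_smul_axis he hw hew s t).trans (abs_of_nonneg hs)⟩

end UnitAxis

/-- `f` is invariant under the rotations about the axis `ℝe`: it depends only on the cylindrical
coordinates. For a set `L`, this is applied to the membership predicate `(· ∈ L)`. -/
def IsAxiallySymmetric {α : Type*} (e : V) (f : V → α) : Prop :=
  ∀ x y, ‖x‖ = ‖y‖ → ⟪e, x⟫_ℝ = ⟪e, y⟫_ℝ → f x = f y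

theorem seminorm_add_smul_le_of_abs_le (p : Seminorm ℝ V) {a b : V} {t t' : ℝ} (htt' : |t| ≤ t')
    (hp : p (a + -t' • b) = p (a + t' • b)) : p (a + t • b) ≤ p (a + t' • b) := by
  have hconv : ConvexOn ℝ univ fun t : ℝ => p (a + t • b) := by
    have h := p.convexOn.comp_affineMap (AffineMap.lineMap a (a + b))
    simpa only [AffineMap.lineMap_apply, Function.comp_def, vsub_eq_sub, vadd_eq_add,
      add_sub_cancel_left, preimage_univ, add_comm] using h
  have h := hconv.le_max_of_mem_Icc (mem_univ (-t')) (mem_univ t') (abs_le.1 htt')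
  simpa only [hp, max_self] using h

theorem seminorm_add_eq_of_eq_zero (p : Seminorm ℝ V) {v : V} (hv : p v = 0) (x : V) :
    p (x + v) = p x := by
  refine le_antisymm ((map_add_le_add p x v).trans_eq (by rw [hv, add_zero])) ?_
  simpa only [add_sub_cancel_right, hv, add_zero] using map_sub_le_add p (x + v) v

theorem seminorm_eq_mul_abs_inner {p : Seminorm ℝ V} {e : V} (he : ‖e‖ = 1)
    (hp : ∀ v, ⟪e, v⟫_ℝ = 0 → p v = 0) (x : V) : p x = p e * |⟪e, x⟫_ℝ| := by
  have h := seminorm_add_eq_of_eq_zero p (hp _ (inner_sub_inner_smul he x)) (⟪e, x⟫_ℝ • e)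
  rwa [add_sub_cancel, map_smul_eq_mul, Real.norm_eq_abs, mul_comm] at h

namespace IsAxiallySymmetric

variable {e : V} {p : Seminorm ℝ V} (he : ‖e‖ = 1)
include he

theorem map_eq_of_axisDist_eq (hp : IsAxiallySymmetric e p) {x y : V}
    (ht : |⟪e, x⟫_ℝ| = |⟪e, y⟫_ℝ|) (hs : axisDist e x = axisDist e y) : p x = p y := by
  have hnorm : ‖x‖ = ‖y‖ := by
    have hsq := axisDist_sq he x
    rw [hs, axisDist_sq he y, sq_eq_sq_iff_abs_eq_abs _ _ |>.2 ht, sub_left_inj] at hsq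
    exact ((sq_eq_sq₀ (norm_nonneg y) (norm_nonneg x)).1 hsq).symm
  rcases abs_eq_abs.1 ht with h | h
  · exact hp x y hnorm h
  · rw [← map_neg_eq_map p y]
    exact hp x (-y) (by rw [hnorm, norm_neg]) (by rw [h, inner_neg_right])

/-- Averaging `y` with its reflections in the axis and in the hyperplane `e^⊥` can only decrease
a seminorm, and reaches every point with smaller cylindrical coordinates. -/
theorem map_le_map (hp : IsAxiallySymmetric e p) (hV : 1 < Module.finrank ℝ V) {x y : V}
    (ht : |⟪e, x⟫_ℝ| ≤ |⟪e, y⟫_ℝ|) (hs : axisDist e x ≤ axisDist e y) : p x ≤ p y := by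
  obtain ⟨w, hw, hew⟩ := exists_norm_eq_one_forall_inner_eq_zero {e} (by simpa using hV)
  replace hew : ⟪e, w⟫_ℝ = 0 := hew e (Finset.mem_singleton_self e)
  have hcyl : ∀ s t s' t' : ℝ, |s| = |s'| → |t| = |t'| →
      p (s • w + t • e) = p (s' • w + t' • e) := fun s t s' t' hs ht =>
    hp.map_eq_of_axisDist_eq he
      (by simpa only [inner_smul_add_smul_axis he hew] using ht)
      (by simpa only [axisDist_smul_add_smul_axis he hw hew] using hs)
  have heq : ∀ z, p z = p (axisDist e z • w + |⟪e, z⟫_ℝ| • e) := fun z =>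
    hp.map_eq_of_axisDist_eq he
      (by rw [inner_smul_add_smul_axis he hew, abs_abs])
      (by rw [axisDist_smul_add_smul_axis he hw hew, abs_of_nonneg (axisDist_nonneg e z)])
  calc
    p x = p (axisDist e x • w + |⟪e, x⟫_ℝ| • e) := heq x
    _ ≤ p (axisDist e x • w + |⟪e, y⟫_ℝ| • e) :=
      seminorm_add_smul_le_of_abs_le p (by rwa [abs_abs]) (hcyl _ _ _ _ rfl (abs_neg _))
    _ ≤ p (axisDist e y • w + |⟪e, y⟫_ℝ| • e) := by
      simp only [add_comm _ (|⟪e, y⟫_ℝ| • e)]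
      refine seminorm_add_smul_le_of_abs_le p (by rwa [abs_of_nonneg (axisDist_nonneg e x)]) ?_
      rw [add_comm (|⟪e, y⟫_ℝ| • e), add_comm (|⟪e, y⟫_ℝ| • e)]
      exact hcyl _ _ _ _ (abs_neg _) rfl
    _ = p y := (heq y).symm

theorem zero_le_sub_mul_axisDist_mul (hp : IsAxiallySymmetric e p)
    (hV : 1 < Module.finrank ℝ V) {z : V} (hz1 : ⟪e, z⟫_ℝ = 1) (hz0 : 0 < axisDist e z) (x : V) :
    0 ≤ (p x - p z / axisDist e z * axisDist e x) *
      (axisDist e z ^ 2 * ⟪e, x⟫_ℝ ^ 2 - axisDist e x ^ 2) := by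
  have hcmp : p ((axisDist e x / axisDist e z) • z) = p z / axisDist e z * axisDist e x := by
    rw [map_smul_eq_mul, Real.norm_eq_abs, abs_div, abs_of_nonneg (axisDist_nonneg e x),
      abs_of_pos hz0]
    ring
  have ht : |⟪e, (axisDist e x / axisDist e z) • z⟫_ℝ| = axisDist e x / axisDist e z := by
    rw [inner_smul_right, hz1, mul_one, abs_of_nonneg (div_nonneg (axisDist_nonneg e x) hz0.le)]
  have hs : axisDist e ((axisDist e x / axisDist e z) • z) = axisDist e x := by
    rw [axisDist_smul, abs_of_nonneg (div_nonneg (axisDist_nonneg e x) hz0.le),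
      div_mul_cancel₀ _ hz0.ne']
  rw [← hcmp, ← sq_abs ⟪e, x⟫_ℝ, ← mul_pow]
  rcases le_total (axisDist e x / axisDist e z) |⟪e, x⟫_ℝ| with h | h
  · refine mul_nonneg (sub_nonneg.2 (hp.map_le_map he hV (ht.trans_le h) hs.le)) (sub_nonneg.2 ?_)
    gcongr
    · exact axisDist_nonneg e x
    · rwa [← div_le_iff₀' hz0]
  · refine mul_nonneg_of_nonpos_of_nonpos
      (sub_nonpos.2 (hp.map_le_map he hV (h.trans_eq ht.symm) hs.ge)) (sub_nonpos.2 ?_)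
    gcongr
    rwa [← le_div_iff₀' hz0]

theorem zero_le_sub_mul_abs_inner_mul (hp : IsAxiallySymmetric e p)
    (hV : 1 < Module.finrank ℝ V) {z : V} (hz1 : ⟪e, z⟫_ℝ = 1) (x : V) :
    0 ≤ (p x - p z * |⟪e, x⟫_ℝ|) * (axisDist e x ^ 2 - axisDist e z ^ 2 * ⟪e, x⟫_ℝ ^ 2) := by
  have hcmp : p (|⟪e, x⟫_ℝ| • z) = p z * |⟪e, x⟫_ℝ| := by
    rw [map_smul_eq_mul, Real.norm_eq_abs, abs_abs, mul_comm]
  have ht : |⟪e, |⟪e, x⟫_ℝ| • z⟫_ℝ| = |⟪e, x⟫_ℝ| := by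
    rw [inner_smul_right, hz1, mul_one, abs_abs]
  have hs : axisDist e (|⟪e, x⟫_ℝ| • z) = axisDist e z * |⟪e, x⟫_ℝ| := by
    rw [axisDist_smul, abs_abs, mul_comm]
  rw [← hcmp, ← sq_abs ⟪e, x⟫_ℝ, ← mul_pow, ← hs]
  rcases le_total (axisDist e (|⟪e, x⟫_ℝ| • z)) (axisDist e x) with h | h
  · refine mul_nonneg (sub_nonneg.2 (hp.map_le_map he hV ht.le h)) (sub_nonneg.2 ?_)
    gcongr
    exact axisDist_nonneg _ _
  · refine mul_nonneg_of_nonpos_of_nonpos (sub_nonpos.2 (hp.map_le_map he hV ht.ge h))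
      (sub_nonpos.2 ?_)
    gcongr
    exact axisDist_nonneg _ _

theorem eq_mul_axisDist_of_map_axis_eq_zero (hp : IsAxiallySymmetric e p) (hpe : p e = 0) {z : V}
    (hz0 : axisDist e z ≠ 0) (x : V) : p x = p z / axisDist e z * axisDist e x := by
  have hproj : ∀ y, p (y + -⟪e, y⟫_ℝ • e) = p y := fun y =>
    seminorm_add_eq_of_eq_zero p (by rw [map_smul_eq_mul, hpe, mul_zero]) y
  have hinner : ∀ y, ⟪e, y + -⟪e, y⟫_ℝ • e⟫_ℝ = 0 := fun y => by
    rw [neg_smul, ← sub_eq_add_neg, inner_sub_inner_smul he]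
  calc
    p x = p (x + -⟪e, x⟫_ℝ • e) := (hproj x).symm
    _ = p ((axisDist e x / axisDist e z) • (z + -⟪e, z⟫_ℝ • e)) := by
      refine hp.map_eq_of_axisDist_eq he ?_ ?_
      · rw [inner_smul_right, hinner, hinner, mul_zero]
      · rw [axisDist_smul, axisDist_add_smul he, axisDist_add_smul he, abs_div,
          abs_of_nonneg (axisDist_nonneg e x), abs_of_nonneg (axisDist_nonneg e z),
          div_mul_cancel₀ _ hz0]
    _ = p z / axisDist e z * axisDist e x := by
      rw [map_smul_eq_mul, hproj, Real.norm_eq_abs, abs_div,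
        abs_of_nonneg (axisDist_nonneg e x), abs_of_nonneg (axisDist_nonneg e z)]
      ring

end IsAxiallySymmetric

section Moments

theorem continuous_seminorm [FiniteDimensional ℝ V] (p : Seminorm ℝ V) : Continuous p :=
  continuousOn_univ.1 (p.convexOn.continuousOn isOpen_univ)

theorem hasDerivAt_mul_abs (t : ℝ) : HasDerivAt (fun t : ℝ => t * |t|) (2 * |t|) t := by
  rcases eq_or_ne t 0 with rfl | ht
  · rw [hasDerivAt_iff_tendsto_slope]
    have habs : Filter.Tendsto (fun t : ℝ => |t|) (nhdsWithin 0 {0}ᶜ) (nhds (2 * |0|)) := by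
      simpa using (continuous_abs.tendsto (0 : ℝ)).mono_left nhdsWithin_le_nhds
    refine habs.congr' ?_
    filter_upwards [self_mem_nhdsWithin] with t ht
    rw [slope_def_field, zero_mul, sub_zero, sub_zero, mul_div_cancel_left₀ _ ht]
  · refine ((hasDerivAt_id t).mul (hasDerivAt_abs ht)).congr_deriv ?_
    rw [id_eq, self_mul_sign, one_mul, two_mul]

variable {e : V} (he : ‖e‖ = 1)
include he

theorem hasLineDerivAt_comp_inner {g : ℝ → ℝ} {g' : ℝ} {x : V}
    (hg : HasDerivAt g g' ⟪e, x⟫_ℝ) : HasLineDerivAt ℝ (fun x => g ⟪e, x⟫_ℝ) g' x e := by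
  have h : HasDerivAt (fun t : ℝ => ⟪e, x + t • e⟫_ℝ) 1 0 := by
    simp only [inner_add_right, inner_smul_right, inner_self_eq_one_of_norm_eq_one he, mul_one]
    exact (hasDerivAt_id (0 : ℝ)).const_add ⟪e, x⟫_ℝ
  exact (HasDerivAt.comp (0 : ℝ) (by simpa using hg) h).congr_deriv (mul_one g')

theorem hasLineDerivAt_inner_mul_axisDist (x : V) :
    HasLineDerivAt ℝ (fun x => ⟪e, x⟫_ℝ * axisDist e x) (axisDist e x) x e := by
  have h := hasLineDerivAt_comp_inner he ((hasDerivAt_id ⟪e, x⟫_ℝ).mul_const (axisDist e x))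
  simpa only [HasLineDerivAt, axisDist_add_smul he, id_eq, one_mul] using h

variable [FiniteDimensional ℝ V] [MeasurableSpace V] [BorelSpace V] [Nontrivial V]
  (μ : Measure V) [μ.IsAddHaarMeasure]

theorem integral_axisDist_mul_eq_zero :
    ∫ u : sphere (0 : V) 1, axisDist e (u : V) *
      ((Module.finrank ℝ V + 1) * ⟪e, (u : V)⟫_ℝ ^ 2 - 1) ∂μ.toSphere = 0 := by
  rw [← integral_toSphere_divergence_eq_zero μ (v := e)
    ((isPosHomogeneous_inner e).mul (isPosHomogeneous_axisDist e)) (by fun_prop)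
    (isPosHomogeneous_axisDist e) (by fun_prop) (hasLineDerivAt_inner_mul_axisDist he)]
  congr! 2
  push_cast
  ring

theorem integral_abs_inner_mul_eq_zero :
    ∫ u : sphere (0 : V) 1, |⟪e, (u : V)⟫_ℝ| *
      (1 - (Module.finrank ℝ V + 1) / 2 * ⟪e, (u : V)⟫_ℝ ^ 2) ∂μ.toSphere = 0 := by
  have habs : IsPosHomogeneous 1 fun x : V => |⟪e, x⟫_ℝ| := fun r hr x => by
    simp only [inner_smul_right, abs_mul, abs_of_nonneg hr, pow_one]
  have h := integral_toSphere_divergence_eq_zero μ (v := e) ((isPosHomogeneous_inner e).mul habs)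
    (by fun_prop) (habs.const_mul 2) (by fun_prop)
    fun x => hasLineDerivAt_comp_inner he (hasDerivAt_mul_abs _)
  rw [← neg_eq_zero, ← mul_zero (2⁻¹ : ℝ), ← h, ← integral_const_mul, ← integral_neg]
  congr! 2
  push_cast
  ring

end Moments

section WeightedIntegrals

variable [FiniteDimensional ℝ V] [MeasurableSpace V] [BorelSpace V] (μ : Measure V)
  [μ.IsAddHaarMeasure] {e : V} (he : ‖e‖ = 1) (hV : 1 < Module.finrank ℝ V) {p : Seminorm ℝ V}
include he hV

theorem IsAxiallySymmetric.integral_mul_nonneg_and_eq_zero_iff_map_axis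
    (hp : IsAxiallySymmetric e p) :
    0 ≤ ∫ u : sphere (0 : V) 1, p u * ((Module.finrank ℝ V + 1) * ⟪e, (u : V)⟫_ℝ ^ 2 - 1)
        ∂μ.toSphere ∧
      (∫ u : sphere (0 : V) 1, p u * ((Module.finrank ℝ V + 1) * ⟪e, (u : V)⟫_ℝ ^ 2 - 1)
        ∂μ.toSphere = 0 ↔ p e = 0) := by
  have : Nontrivial V := Module.nontrivial_of_finrank_pos (Nat.zero_lt_of_lt hV)
  have hpc := continuous_seminorm p
  -- `z` lies on the cone where the weight vanishes.
  obtain ⟨z, hz1, hz⟩ := exists_inner_eq_axisDist_eq he hV 1 (Real.sqrt_nonneg (Module.finrank ℝ V))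
  have hz0 : 0 < axisDist e z := by
    rw [hz]
    positivity
  have hzsq : axisDist e z ^ 2 = Module.finrank ℝ V := by rw [hz, Real.sq_sqrt (by positivity)]
  have hweight (u : sphere (0 : V) 1) : (Module.finrank ℝ V + 1) * ⟪e, (u : V)⟫_ℝ ^ 2 - 1 =
      axisDist e z ^ 2 * ⟪e, (u : V)⟫_ℝ ^ 2 - axisDist e (u : V) ^ 2 := by
    rw [hzsq, axisDist_sq he, norm_eq_of_mem_sphere]
    ring
  obtain ⟨hnonneg, heq⟩ := integral_mul_nonneg_and_eq_zero_iff μ.toSphere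
    (f := fun u => p u) (k := fun u => p z / axisDist e z * axisDist e (u : V))
    (g := fun u => (Module.finrank ℝ V + 1) * ⟪e, (u : V)⟫_ℝ ^ 2 - 1)
    (by fun_prop) (by fun_prop) (by fun_prop)
    (by simp only [mul_assoc, integral_const_mul, integral_axisDist_mul_eq_zero he, mul_zero])
    (fun u => (hp.zero_le_sub_mul_axisDist_mul he hV hz1 hz0 u).trans_eq (by rw [hweight]))
  refine ⟨hnonneg, heq.trans ⟨fun h => ?_, fun hpe u => ?_⟩⟩
  · have h := h ⟨e, by simpa using he⟩
    rw [hweight] at h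
    simpa [axisDist_self he, he, ne_zero_of_norm_ne_zero (he ▸ one_ne_zero), hz0.ne'] using h
  · rw [← hp.eq_mul_axisDist_of_map_axis_eq_zero he hpe hz0.ne', sub_self, zero_mul]

theorem IsAxiallySymmetric.integral_mul_nonneg_and_eq_zero_iff_map_orthogonal
    (hp : IsAxiallySymmetric e p) :
    0 ≤ ∫ u : sphere (0 : V) 1, p u * (1 - (Module.finrank ℝ V + 1) / 2 * ⟪e, (u : V)⟫_ℝ ^ 2)
        ∂μ.toSphere ∧
      (∫ u : sphere (0 : V) 1, p u * (1 - (Module.finrank ℝ V + 1) / 2 * ⟪e, (u : V)⟫_ℝ ^ 2)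
        ∂μ.toSphere = 0 ↔ ∀ v, ⟪e, v⟫_ℝ = 0 → p v = 0) := by
  have : Nontrivial V := Module.nontrivial_of_finrank_pos (Nat.zero_lt_of_lt hV)
  have hpc := continuous_seminorm p
  -- `z` lies on the cone where the weight vanishes.
  obtain ⟨z, hz1, hz⟩ := exists_inner_eq_axisDist_eq he hV 1
    (Real.sqrt_nonneg ((Module.finrank ℝ V - 1) / 2))
  have hzsq : axisDist e z ^ 2 = (Module.finrank ℝ V - 1) / 2 := by
    have : (1 : ℝ) < Module.finrank ℝ V := by exact_mod_cast hV
    rw [hz, Real.sq_sqrt (by linarith)]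
  have hweight (u : sphere (0 : V) 1) : 1 - (Module.finrank ℝ V + 1) / 2 * ⟪e, (u : V)⟫_ℝ ^ 2 =
      axisDist e (u : V) ^ 2 - axisDist e z ^ 2 * ⟪e, (u : V)⟫_ℝ ^ 2 := by
    rw [hzsq, axisDist_sq he, norm_eq_of_mem_sphere]
    ring
  obtain ⟨hnonneg, heq⟩ := integral_mul_nonneg_and_eq_zero_iff μ.toSphere
    (f := fun u => p u) (k := fun u => p z * |⟪e, (u : V)⟫_ℝ|)
    (g := fun u => 1 - (Module.finrank ℝ V + 1) / 2 * ⟪e, (u : V)⟫_ℝ ^ 2)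
    (by fun_prop) (by fun_prop) (by fun_prop)
    (by simp only [mul_assoc, integral_const_mul, integral_abs_inner_mul_eq_zero he, mul_zero])
    (fun u => (hp.zero_le_sub_mul_abs_inner_mul he hV hz1 u).trans_eq (by rw [hweight]))
  refine ⟨hnonneg, heq.trans ⟨fun h v hv => ?_, fun hpv u => ?_⟩⟩
  · rcases eq_or_ne v 0 with rfl | hv0
    · exact map_zero p
    have h := h ⟨‖v‖⁻¹ • v, by simpa using norm_smul_inv_norm (𝕜 := ℝ) hv0⟩
    simpa [inner_smul_right, hv, map_smul_eq_mul, hv0] using h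
  · have hpp := seminorm_eq_mul_abs_inner he hpv
    rw [hpp z, hpp u, hz1, abs_one, mul_one, sub_self, zero_mul]

end WeightedIntegrals

end AxialSymmetry

section Width

variable {V : Type*} [NormedAddCommGroup V] [InnerProductSpace ℝ V]

/-- The support function `h_L(x) = max {⟪y, x⟫ : y ∈ L}` on the whole space, of which the one on the
sphere is a restriction. -/
def supportFunction (L : ConvexBody V) (x : V) : ℝ := sSup ((fun y : V => ⟪y, x⟫_ℝ) '' (L : Set V))

variable {L : ConvexBody V}

theorem continuous_supportFunction : Continuous (supportFunction L) :=
  L.isCompact.continuous_sSup (f := fun x y : V => ⟪y, x⟫_ℝ) (by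
    change Continuous fun p : V × V => ⟪p.2, p.1⟫_ℝ
    fun_prop)

theorem inner_le_supportFunction (x : V) {y : V} (hy : y ∈ L) : ⟪y, x⟫_ℝ ≤ supportFunction L x :=
  le_csSup (L.isCompact.bddAbove_image (by fun_prop)) (mem_image_of_mem _ hy)

theorem exists_supportFunction_eq_inner (L : ConvexBody V) (x : V) :
    ∃ y ∈ L, supportFunction L x = ⟪y, x⟫_ℝ :=
  L.isCompact.exists_sSup_image_eq L.nonempty (by fun_prop)

theorem inner_sub_le_supportFunction_add (x : V) {y z : V} (hy : y ∈ L) (hz : z ∈ L) :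
    ⟪y - z, x⟫_ℝ ≤ supportFunction L x + supportFunction L (-x) := by
  have h := add_le_add (inner_le_supportFunction x hy) (inner_le_supportFunction (-x) hz)
  rwa [inner_neg_right, ← sub_eq_add_neg, ← inner_sub_left] at h

theorem exists_supportFunction_add_eq_inner_sub (L : ConvexBody V) (x : V) :
    ∃ y ∈ L, ∃ z ∈ L, supportFunction L x + supportFunction L (-x) = ⟪y - z, x⟫_ℝ := by
  obtain ⟨y, hy, hxy⟩ := exists_supportFunction_eq_inner L x
  obtain ⟨z, hz, hxz⟩ := exists_supportFunction_eq_inner L (-x)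
  exact ⟨y, hy, z, hz, by rw [hxy, hxz, inner_neg_right, inner_sub_left, sub_eq_add_neg]⟩

/-- The width `h_L(x) + h_L(-x)` of `L` in the direction `x`, as a seminorm. -/
def width (L : ConvexBody V) : Seminorm ℝ V :=
  Seminorm.ofSMulLE (fun x => supportFunction L x + supportFunction L (-x))
    (by
      obtain ⟨y, -, z, -, h⟩ := exists_supportFunction_add_eq_inner_sub L 0
      rw [h, inner_zero_right])
    (fun x x' => by
      obtain ⟨y, hy, z, hz, h⟩ := exists_supportFunction_add_eq_inner_sub L (x + x')
      rw [h, inner_add_right]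
      exact add_le_add (inner_sub_le_supportFunction_add x hy hz)
        (inner_sub_le_supportFunction_add x' hy hz))
    (fun r x => by
      obtain ⟨y, hy, z, hz, h⟩ := exists_supportFunction_add_eq_inner_sub L (r • x)
      have habs : |⟪y - z, x⟫_ℝ| ≤ supportFunction L x + supportFunction L (-x) := by
        refine abs_le'.2 ⟨inner_sub_le_supportFunction_add x hy hz, ?_⟩
        rw [← inner_neg_left, neg_sub]
        exact inner_sub_le_supportFunction_add x hz hy
      rw [h, inner_smul_right]
      refine (le_abs_self _).trans ?_
      rw [abs_mul, Real.norm_eq_abs]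
      gcongr)

theorem width_apply (L : ConvexBody V) (x : V) :
    width L x = supportFunction L x + supportFunction L (-x) := rfl

theorem width_eq_zero_iff {x : V} :
    width L x = 0 ↔ ∀ y ∈ L, ∀ z ∈ L, ⟪y, x⟫_ℝ = ⟪z, x⟫_ℝ := by
  refine ⟨fun h y hy z hz => ?_, fun h => ?_⟩
  · have hle : ∀ y ∈ L, ∀ z ∈ L, ⟪y, x⟫_ℝ ≤ ⟪z, x⟫_ℝ := fun y hy z hz => by
      rw [← sub_nonpos, ← inner_sub_left, ← h]
      exact inner_sub_le_supportFunction_add x hy hz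
    exact le_antisymm (hle y hy z hz) (hle z hz y hy)
  · obtain ⟨y, hy, z, hz, hyz⟩ := exists_supportFunction_add_eq_inner_sub L x
    rw [width_apply, hyz, inner_sub_left, h y hy z hz, sub_self]

theorem exists_norm_eq_one_width_ne_zero (hL : (L : Set V).Nontrivial) :
    ∃ u : V, ‖u‖ = 1 ∧ width L u ≠ 0 := by
  obtain ⟨y, hy, z, hz, hyz⟩ := hL
  refine ⟨‖y - z‖⁻¹ • (y - z), norm_smul_inv_norm (sub_ne_zero.2 hyz), fun h => ?_⟩
  have h := sub_eq_zero.2 (width_eq_zero_iff.1 h y hy z hz)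
  rw [← inner_sub_left, inner_smul_right, mul_eq_zero, inner_self_eq_zero, inv_eq_zero,
    norm_eq_zero, or_self, sub_eq_zero] at h
  exact hyz h

theorem IsAxiallySymmetric.supportFunction {e : V} (hL : IsAxiallySymmetric e (· ∈ L)) :
    IsAxiallySymmetric e (supportFunction L) := by
  have hle : ∀ x x' : V, ‖x‖ = ‖x'‖ → ⟪e, x⟫_ℝ = ⟪e, x'⟫_ℝ →
      ConvexRevolution.supportFunction L x ≤ ConvexRevolution.supportFunction L x' := by
    intro x x' hnorm hinner
    obtain ⟨y, hy, hxy⟩ := exists_supportFunction_eq_inner L x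
    let R := (ℝ ∙ (x - x'))ᗮ.reflection
    have hRx : R x = x' := Submodule.reflection_sub hnorm
    have hRe : R e = e := Submodule.reflection_mem_subspace_eq_self
      (Submodule.mem_orthogonal_singleton_iff_inner_left.2
        (by rw [inner_sub_right, hinner, sub_self]))
    have hRy : R y ∈ L := (hL y (R y) (R.norm_map y).symm
      (by rw [← R.inner_map_map e y, hRe])).mp hy
    rw [hxy, ← R.inner_map_map, hRx]
    exact inner_le_supportFunction x' hRy
  exact fun x x' hnorm hinner => le_antisymm (hle x x' hnorm hinner)
    (hle x' x hnorm.symm hinner.symm)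

theorem IsAxiallySymmetric.width {e : V} (hL : IsAxiallySymmetric e (· ∈ L)) :
    IsAxiallySymmetric e (width L) := by
  intro x x' hnorm hinner
  rw [width_apply, width_apply, hL.supportFunction x x' hnorm hinner,
    hL.supportFunction (-x) (-x') (by simpa using hnorm) (by simpa using hinner)]

theorem integral_width_mul [FiniteDimensional ℝ V] [MeasurableSpace V] [BorelSpace V]
    (L : ConvexBody V) (μ : Measure V) [μ.IsAddHaarMeasure] {g : V → ℝ} (hgc : Continuous g)
    (hg : g.Even) :
    ∫ u : sphere (0 : V) 1, width L u * g u ∂μ.toSphere =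
      2 * ∫ u : sphere (0 : V) 1, supportFunction L u * g u ∂μ.toSphere := by
  have hint : Integrable (fun u : sphere (0 : V) 1 => supportFunction L u * g u) μ.toSphere :=
    ((continuous_supportFunction.mul hgc).comp continuous_subtype_val)
      |>.integrable_of_hasCompactSupport (.of_compactSpace _)
  have hneg := integral_comp_neg_toSphere μ fun u => supportFunction L u * g u
  simp only [coe_neg_sphere, hg _] at hneg
  simp only [width_apply, add_mul]
  rw [integral_add hint, hneg, two_mul]
  simpa only [Function.comp_def, coe_neg_sphere, hg _] using
    (measurePreserving_neg_toSphere μ).integrable_comp_of_integrable hint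

end Width

section Shapes

section General

variable {V : Type*} [NormedAddCommGroup V] [InnerProductSpace ℝ V]

theorem reflection_orthogonal_singleton_eq_self {a b : V} (h : ⟪b, a⟫_ℝ = 0) :
    (ℝ ∙ a)ᗮ.reflection b = b :=
  Submodule.reflection_mem_subspace_eq_self
    (Submodule.mem_orthogonal_singleton_iff_inner_left.2 h)

theorem det_reflection_orthogonal_singleton [FiniteDimensional ℝ V] {a : V} (ha : a ≠ 0) :
    LinearMap.det ((ℝ ∙ a)ᗮ.reflection.toLinearEquiv : V →ₗ[ℝ] V) = -1 := by
  have h := (ℝ ∙ a)ᗮ.det_reflection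
  rwa [Submodule.orthogonal_orthogonal, finrank_span_singleton ha, pow_one] at h

theorem exists_norm_eq_one_inner_eq_zero_pair (hV : 3 ≤ Module.finrank ℝ V) (a b : V) :
    ∃ w : V, ‖w‖ = 1 ∧ ⟪a, w⟫_ℝ = 0 ∧ ⟪b, w⟫_ℝ = 0 := by
  classical
  obtain ⟨w, hw, h⟩ := exists_norm_eq_one_forall_inner_eq_zero {a, b}
    (Finset.card_le_two.trans_lt hV)
  exact ⟨w, hw, h a (by simp), h b (by simp)⟩

/-- The reflection exchanging two points of equal cylindrical coordinates becomes a rotation about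
`e` after composition with a reflection fixing both `e` and the second point; the latter exists
because the dimension is at least `3`. -/
theorem isAxiallySymmetric_mem_of_rotation_image_eq (hV : 3 ≤ Module.finrank ℝ V) {e : V}
    {A : Set V} (hA : ∀ θ : V ≃ₗᵢ[ℝ] V, LinearMap.det (θ.toLinearEquiv : V →ₗ[ℝ] V) = 1 →
      θ e = e → θ '' A = A) : IsAxiallySymmetric e (· ∈ A) := by
  have : FiniteDimensional ℝ V := Module.finite_of_finrank_pos (by omega)
  have hmem : ∀ x y : V, ‖x‖ = ‖y‖ → ⟪e, x⟫_ℝ = ⟪e, y⟫_ℝ → x ∈ A → y ∈ A := by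
    intro x y hnorm hinner hx
    rcases eq_or_ne x y with rfl | hne
    · exact hx
    obtain ⟨w, hw, hew, hyw⟩ := exists_norm_eq_one_inner_eq_zero_pair hV e y
    let θ : V ≃ₗᵢ[ℝ] V := (ℝ ∙ (x - y))ᗮ.reflection.trans (ℝ ∙ w)ᗮ.reflection
    have hθx : θ x = y := by
      rw [LinearIsometryEquiv.trans_apply, Submodule.reflection_sub hnorm,
        reflection_orthogonal_singleton_eq_self hyw]
    have hθe : θ e = e := by
      have hxy : ⟪e, x - y⟫_ℝ = 0 := by rw [inner_sub_right, hinner, sub_self]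
      rw [LinearIsometryEquiv.trans_apply, reflection_orthogonal_singleton_eq_self hxy,
        reflection_orthogonal_singleton_eq_self hew]
    have hdet : LinearMap.det (θ.toLinearEquiv : V →ₗ[ℝ] V) = 1 := by
      change LinearMap.det (((ℝ ∙ w)ᗮ.reflection.toLinearEquiv : V →ₗ[ℝ] V) ∘ₗ
        ((ℝ ∙ (x - y))ᗮ.reflection.toLinearEquiv : V →ₗ[ℝ] V)) = 1
      rw [LinearMap.det_comp,
        det_reflection_orthogonal_singleton (ne_zero_of_norm_ne_zero (hw ▸ one_ne_zero)),
        det_reflection_orthogonal_singleton (sub_ne_zero.2 hne), neg_mul_neg, one_mul]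
    rw [← hA θ hdet hθe, ← hθx]
    exact mem_image_of_mem θ hx
  exact fun x y hnorm hinner =>
    propext ⟨hmem x y hnorm hinner, hmem y x hnorm.symm hinner.symm⟩

variable {e : V}

/-- `y` is the midpoint of two points of the same cylindrical coordinates as `x`. -/
theorem IsAxiallySymmetric.mem_of_axisDist_le (he : ‖e‖ = 1) (hV : 3 ≤ Module.finrank ℝ V)
    {A : Set V} (hA : IsAxiallySymmetric e (· ∈ A)) (hconv : Convex ℝ A) {x y : V} (hx : x ∈ A)
    (hinner : ⟪e, x⟫_ℝ = ⟪e, y⟫_ℝ) (hdist : axisDist e y ≤ axisDist e x) : y ∈ A := by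
  obtain ⟨w, hw, hew, hyw⟩ := exists_norm_eq_one_inner_eq_zero_pair hV e y
  have hr : 0 ≤ ‖x‖ ^ 2 - ‖y‖ ^ 2 := by
    have h := pow_le_pow_left₀ (axisDist_nonneg e y) hdist 2
    rw [axisDist_sq he, axisDist_sq he, hinner] at h
    linarith
  have hmem : ∀ r : ℝ, r ^ 2 = ‖x‖ ^ 2 - ‖y‖ ^ 2 → y + r • w ∈ A := by
    intro r hr
    refine (hA x (y + r • w) ?_ ?_).mp hx
    · refine (sq_eq_sq₀ (norm_nonneg _) (norm_nonneg _)).1 ?_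
      rw [norm_add_sq_real, norm_smul, hw, inner_smul_right, hyw, Real.norm_eq_abs, mul_one, sq_abs,
        hr]
      ring
    · rw [inner_add_right, inner_smul_right, hew, mul_zero, add_zero, hinner]
  have hmid := hconv.midpoint_mem (hmem (√(‖x‖ ^ 2 - ‖y‖ ^ 2)) (Real.sq_sqrt hr))
    (hmem (-√(‖x‖ ^ 2 - ‖y‖ ^ 2)) (by rw [neg_sq, Real.sq_sqrt hr]))
  rwa [neg_smul, ← sub_eq_add_neg, midpoint_add_sub] at hmid

theorem sub_eq_inner_smul_of_width_eq_zero (he : ‖e‖ = 1) {L : ConvexBody V}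
    (hL : ∀ v, ⟪e, v⟫_ℝ = 0 → width L v = 0) {y z : V} (hy : y ∈ L) (hz : z ∈ L) :
    y - z = ⟪e, y - z⟫_ℝ • e := by
  have hev := inner_sub_inner_smul he (y - z)
  have h := width_eq_zero_iff.1 (hL _ hev) y hy z hz
  rw [← sub_eq_zero, ← inner_self_eq_zero (𝕜 := ℝ)]
  rw [← sub_eq_zero, ← inner_sub_left] at h
  conv_lhs => rw [inner_sub_left, h, inner_smul_left, hev, mul_zero, sub_zero]

end General

variable {n : ℕ} {e : S n} {L : ConvexBody (E n)}

theorem IsDisk.width_axis_eq_zero (hn : 3 ≤ n) (hL : IsAxiallySymmetric (e : E n) (· ∈ L))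
    (hdisk : IsDisk (L : Set (E n))) : width L (e : E n) = 0 := by
  have he : ‖(e : E n)‖ = 1 := norm_eq_of_mem_sphere e
  have hV : 3 ≤ Module.finrank ℝ (E n) := by rwa [finrank_euclideanSpace_fin]
  obtain ⟨c, ν, r, hr, hLeq⟩ := hdisk
  have hmem : ∀ x, x ∈ L ↔ ⟪x - c, (ν : E n)⟫_ℝ = 0 ∧ ‖x - c‖ ≤ r := fun x => by
    rw [← SetLike.mem_coe, hLeq]; rfl
  have hν : width L (ν : E n) = 0 := width_eq_zero_iff.2 fun y hy z hz => by
    rw [sub_eq_zero.1 ((inner_sub_left _ _ _).symm.trans ((hmem y).1 hy).1),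
      sub_eq_zero.1 ((inner_sub_left _ _ _).symm.trans ((hmem z).1 hz).1)]
  have heν : ⟪(e : E n), (ν : E n)⟫_ℝ ≠ 0 := fun heν => by
    obtain ⟨w, hw, hew, hνw⟩ := exists_norm_eq_one_inner_eq_zero_pair hV (e : E n) ν
    have hwν : width L w = width L (ν : E n) := hL.width w ν (by simp [hw]) (hew.trans heν.symm)
    have hcw := width_eq_zero_iff.1 (hwν.trans hν) c ((hmem c).2 (by simpa using hr.le))
      (c + r • w) ((hmem _).2 (by
        rw [add_sub_cancel_left, inner_smul_left, real_inner_comm, hνw, norm_smul, hw,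
          Real.norm_eq_abs, abs_of_pos hr]; simp))
    simp [inner_add_left, inner_smul_left, hw, hr.ne'] at hcw
  have hle := hL.width.map_le_map he (by omega) (x := ⟪(e : E n), (ν : E n)⟫_ℝ • (e : E n))
    (y := ν) (by rw [inner_smul_right, inner_self_eq_one_of_norm_eq_one he, mul_one])
    (by rw [axisDist_smul, axisDist_self he, mul_zero]; exact axisDist_nonneg _ _)
  rw [hν, map_smul_eq_mul] at hle
  exact le_antisymm (nonpos_of_mul_nonpos_right hle (norm_pos_iff.2 heν)) (apply_nonneg _ _)

theorem isDisk_of_width_axis_eq_zero (hn : 3 ≤ n) (hL : IsAxiallySymmetric (e : E n) (· ∈ L))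
    (hpt : (L : Set (E n)).Nontrivial) (h : width L (e : E n) = 0) : IsDisk (L : Set (E n)) := by
  have he : ‖(e : E n)‖ = 1 := norm_eq_of_mem_sphere e
  have hV : 3 ≤ Module.finrank ℝ (E n) := by rwa [finrank_euclideanSpace_fin]
  obtain ⟨x, hx, hmax⟩ := L.isCompact.exists_isMaxOn L.nonempty
    (continuous_axisDist (e : E n)).continuousOn
  have hinner : ∀ y ∈ L, ⟪(e : E n), y⟫_ℝ = ⟪(e : E n), x⟫_ℝ := fun y hy => by
    rw [real_inner_comm, real_inner_comm x]
    exact width_eq_zero_iff.1 h y hy x hx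
  have hdist : ∀ y ∈ L, y - ⟪(e : E n), x⟫_ℝ • (e : E n) = y - ⟪(e : E n), y⟫_ℝ • (e : E n) :=
    fun y hy => by rw [hinner y hy]
  refine ⟨⟪(e : E n), x⟫_ℝ • (e : E n), e, axisDist (e : E n) x, ?_, ?_⟩
  · refine (axisDist_nonneg _ _).lt_of_ne' fun h0 => hpt.not_subsingleton fun y hy z hz => ?_
    have hcenter : ∀ y ∈ L, y = ⟪(e : E n), x⟫_ℝ • (e : E n) := fun y hy => by
      rw [← sub_eq_zero, hdist y hy, ← norm_eq_zero]
      exact le_antisymm ((hmax hy).trans_eq h0) (norm_nonneg _)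
    rw [hcenter y hy, hcenter z hz]
  · ext y
    refine ⟨fun hy => ?_, fun ⟨hye, hyx⟩ => ?_⟩
    · rw [mem_ofPred_eq, hdist y hy, real_inner_comm]
      exact ⟨inner_sub_inner_smul he y, hmax hy⟩
    · have hxy : ⟪(e : E n), x⟫_ℝ = ⟪(e : E n), y⟫_ℝ := by
        rw [real_inner_comm, inner_sub_right, inner_smul_right, inner_self_eq_one_of_norm_eq_one he,
          mul_one, sub_eq_zero] at hye
        exact hye.symm
      rw [hxy] at hyx
      exact hL.mem_of_axisDist_le he hV L.convex hx hxy hyx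

theorem isDisk_iff_width_axis_eq_zero (hn : 3 ≤ n) (hL : IsAxiallySymmetric (e : E n) (· ∈ L))
    (hpt : (L : Set (E n)).Nontrivial) : IsDisk (L : Set (E n)) ↔ width L (e : E n) = 0 :=
  ⟨IsDisk.width_axis_eq_zero hn hL, isDisk_of_width_axis_eq_zero hn hL hpt⟩

theorem IsLineSegment.width_orthogonal_eq_zero (hn : 3 ≤ n)
    (hL : IsAxiallySymmetric (e : E n) (· ∈ L)) (hseg : IsLineSegment (L : Set (E n))) {v : E n}
    (hv : ⟪(e : E n), v⟫_ℝ = 0) : width L v = 0 := by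
  obtain ⟨x, y, -, hLeq⟩ := hseg
  obtain ⟨w, hw, hew, hxyw⟩ := exists_norm_eq_one_inner_eq_zero_pair
    (by rwa [finrank_euclideanSpace_fin]) (e : E n) (y - x)
  have hLw : ∀ z ∈ L, ⟪z, w⟫_ℝ = ⟪x, w⟫_ℝ := fun z hz => by
    rw [← SetLike.mem_coe, hLeq, segment_eq_image'] at hz
    obtain ⟨θ, -, rfl⟩ := hz
    rw [inner_add_left, inner_smul_left, hxyw, mul_zero, add_zero]
  have hwidth : width L w = 0 :=
    width_eq_zero_iff.2 fun y hy z hz => (hLw y hy).trans (hLw z hz).symm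
  rw [hL.width v (‖v‖ • w) (by rw [norm_smul, hw, mul_one, norm_norm])
    (by rw [hv, inner_smul_right, hew, mul_zero]), map_smul_eq_mul, hwidth, mul_zero]

theorem isLineSegment_of_width_orthogonal_eq_zero (hpt : (L : Set (E n)).Nontrivial)
    (h : ∀ v : E n, ⟪(e : E n), v⟫_ℝ = 0 → width L v = 0) : IsLineSegment (L : Set (E n)) := by
  have hsub : ∀ y ∈ L, ∀ z ∈ L, y - z = ⟪(e : E n), y - z⟫_ℝ • (e : E n) := fun y hy z hz =>
    sub_eq_inner_smul_of_width_eq_zero (norm_eq_of_mem_sphere e) h hy hz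
  have hcont : ContinuousOn (fun x => ⟪(e : E n), x⟫_ℝ) L := by fun_prop
  obtain ⟨x, hx, hmin⟩ := L.isCompact.exists_isMinOn L.nonempty hcont
  obtain ⟨y, hy, hmax⟩ := L.isCompact.exists_isMaxOn L.nonempty hcont
  have hxz : ∀ z ∈ L, 0 ≤ ⟪(e : E n), z - x⟫_ℝ := fun z hz => by
    rw [inner_sub_right]; exact sub_nonneg.2 (hmin hz)
  have hzy : ∀ z ∈ L, ⟪(e : E n), z - x⟫_ℝ ≤ ⟪(e : E n), y - x⟫_ℝ := fun z hz => by
    rw [inner_sub_right, inner_sub_right]; exact sub_le_sub_right (hmax hz) _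
  have hne : ⟪(e : E n), y - x⟫_ℝ ≠ 0 := fun h0 => hpt.not_subsingleton fun z hz z' hz' => by
    have heq : ∀ z ∈ L, z = x := fun z hz => by
      rw [← sub_eq_zero, hsub z hz x hx, le_antisymm ((hzy z hz).trans_eq h0) (hxz z hz), zero_smul]
    rw [heq z hz, heq z' hz']
  refine ⟨x, y, fun hxy => hne (by rw [hxy, sub_self, inner_zero_right]),
    Subset.antisymm (fun z hz => ?_) (L.convex.segment_subset hx hy)⟩
  rw [segment_eq_image']
  refine ⟨⟪(e : E n), z - x⟫_ℝ / ⟪(e : E n), y - x⟫_ℝ,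
    ⟨div_nonneg (hxz z hz) (hxz y hy), div_le_one_of_le₀ (hzy z hz) (hxz y hy)⟩, ?_⟩
  change x + _ • (y - x) = z
  rw [hsub y hy x hx, inner_smul_right,
    inner_self_eq_one_of_norm_eq_one (norm_eq_of_mem_sphere e), mul_one, smul_smul,
    div_mul_cancel₀ _ hne, ← hsub z hz x hx, add_sub_cancel]

theorem isLineSegment_iff_width_orthogonal_eq_zero (hn : 3 ≤ n)
    (hL : IsAxiallySymmetric (e : E n) (· ∈ L)) (hpt : (L : Set (E n)).Nontrivial) :
    IsLineSegment (L : Set (E n)) ↔ ∀ v : E n, ⟪(e : E n), v⟫_ℝ = 0 → width L v = 0 :=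
  ⟨fun h _ => h.width_orthogonal_eq_zero hn hL, isLineSegment_of_width_orthogonal_eq_zero hpt⟩

end Shapes

section BoxOperator

section Laplacian

variable {V : Type*} [NormedAddCommGroup V] [InnerProductSpace ℝ V]

theorem laplacian_eq_of_hasFDerivAt [FiniteDimensional ℝ V] {f A B : V → ℝ} {A' B' : V →L[ℝ] ℝ}
    {e x : V} (hf : ∀ᶠ y in nhds x, HasFDerivAt f (A y • innerSL ℝ e + B y • innerSL ℝ y) y)
    (hA : HasFDerivAt A A' x) (hB : HasFDerivAt B B' x) :
    Laplacian.laplacian f x = A' e + B' x + Module.finrank ℝ V * B x := by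
  have hf' : HasFDerivAt (fderiv ℝ f) _ x :=
    ((hA.smul_const (innerSL ℝ e)).add
      (hB.smul (innerSL ℝ (E := V)).hasFDerivAt)).congr_of_eventuallyEq
        (hf.mono fun y hy => hy.fderiv)
  let b := stdOrthonormalBasis ℝ V
  have hsum : ∀ (T : V →L[ℝ] ℝ) (w : V), ∑ i, T (b i) * ⟪w, b i⟫_ℝ = T w := fun T w => by
    conv_rhs => rw [← b.sum_repr' w, map_sum]
    simp only [map_smul, smul_eq_mul, real_inner_comm w, mul_comm]
  rw [InnerProductSpace.laplacian_eq_iteratedFDeriv_orthonormalBasis f b]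
  have hdiag : ∀ i, iteratedFDeriv ℝ 2 f x ![b i, b i] =
      A' (b i) * ⟪e, b i⟫_ℝ + B' (b i) * ⟪x, b i⟫_ℝ + B x := fun i => by
    rw [iteratedFDeriv_two_apply, hf'.fderiv]
    simp [innerSL_apply_apply ℝ, add_comm, add_left_comm]
  simp only [hdiag, Finset.sum_add_distrib, hsum, Finset.sum_const, Finset.card_univ,
    Fintype.card_fin, nsmul_eq_mul]

theorem hasFDerivAt_norm_inv {x : V} (hx : x ≠ 0) :
    HasFDerivAt (fun y : V => ‖y‖⁻¹) (-‖x‖⁻¹ ^ 3 • innerSL ℝ x) x := by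
  have h := (hasStrictFDerivAt_norm_sq x).hasFDerivAt.sqrt (by positivity)
  simp only [Real.sqrt_sq (norm_nonneg _)] at h
  refine ((hasDerivAt_inv (norm_ne_zero_iff.2 hx)).comp_hasFDerivAt x h).congr_fderiv ?_
  ext v
  simp only [one_div, mul_inv_rev, smul_apply, innerSL_apply_apply ℝ, nsmul_eq_mul, Nat.cast_ofNat,
    smul_eq_mul]
  field_simp

theorem hasFDerivAt_norm_inv_mul_inner (e : V) {x : V} (hx : x ≠ 0) :
    HasFDerivAt (fun y : V => ‖y‖⁻¹ * ⟪e, y⟫_ℝ)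
      (‖x‖⁻¹ • innerSL ℝ e + (-(‖x‖⁻¹ ^ 3 * ⟪e, x⟫_ℝ)) • innerSL ℝ x) x := by
  refine ((hasFDerivAt_norm_inv hx).mul (innerSL ℝ e).hasFDerivAt).congr_fderiv ?_
  ext v
  simp only [add_apply, smul_apply, innerSL_apply_apply ℝ, smul_eq_mul]
  ring

theorem laplacian_comp_norm_inv_mul_inner [FiniteDimensional ℝ V] {h h' : ℝ → ℝ} {h'' : ℝ}
    {e x : V} (he : ‖e‖ = 1) (hx : ‖x‖ = 1) (hh : ∀ t, HasDerivAt h (h' t) t)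
    (hh' : HasDerivAt h' h'' ⟪e, x⟫_ℝ) :
    Laplacian.laplacian (fun y => h (‖y‖⁻¹ * ⟪e, y⟫_ℝ)) x =
      (1 - ⟪e, x⟫_ℝ ^ 2) * h'' - (Module.finrank ℝ V - 1) * ⟪e, x⟫_ℝ * h' ⟪e, x⟫_ℝ := by
  have hx0 : x ≠ 0 := ne_zero_of_norm_ne_zero (hx ▸ one_ne_zero)
  have hinv := hasFDerivAt_norm_inv hx0
  have hinner := hasFDerivAt_norm_inv_mul_inner e hx0
  have hcomp : HasFDerivAt (fun y => h' (‖y‖⁻¹ * ⟪e, y⟫_ℝ)) _ x :=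
    HasDerivAt.comp_hasFDerivAt x (by simpa [hx] using hh') hinner
  have hgrad : ∀ᶠ y in nhds x, HasFDerivAt (fun y => h (‖y‖⁻¹ * ⟪e, y⟫_ℝ))
      ((h' (‖y‖⁻¹ * ⟪e, y⟫_ℝ) * ‖y‖⁻¹) • innerSL ℝ e +
        (-(h' (‖y‖⁻¹ * ⟪e, y⟫_ℝ) * (‖y‖⁻¹ ^ 2 * (‖y‖⁻¹ * ⟪e, y⟫_ℝ)))) • innerSL ℝ y) y := by
    filter_upwards [isOpen_ne.mem_nhds hx0] with y hy
    refine ((hh _).comp_hasFDerivAt y (hasFDerivAt_norm_inv_mul_inner e hy)).congr_fderiv ?_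
    ext v
    simp only [add_apply, smul_apply, innerSL_apply_apply ℝ, smul_eq_mul]
    ring
  rw [laplacian_eq_of_hasFDerivAt hgrad (hcomp.mul hinv)
    (hcomp.mul ((hinv.pow 2).mul hinner)).neg]
  simp only [add_apply, neg_apply, smul_apply, innerSL_apply_apply ℝ, smul_eq_mul, nsmul_eq_mul,
    Pi.mul_apply, Nat.cast_ofNat, hx, inv_one, one_mul, one_pow,
    inner_self_eq_one_of_norm_eq_one hx, inner_self_eq_one_of_norm_eq_one he, real_inner_comm e x]
  ring

end Laplacian

variable {n : ℕ} [NeZero n]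

theorem sphLaplacian_zonalLegendre (e u : S n) (k : ℕ) :
    sphLaplacian (zonalLegendre e k) u =
      (1 - ⟪(e : E n), (u : E n)⟫_ℝ ^ 2) *
          (legendre n k).derivative.derivative.eval ⟪(e : E n), (u : E n)⟫_ℝ -
        (n - 1) * ⟪(e : E n), (u : E n)⟫_ℝ *
          (legendre n k).derivative.eval ⟪(e : E n), (u : E n)⟫_ℝ := by
  have hext : homExt (zonalLegendre e k) =ᶠ[nhds (u : E n)]
      fun x => (legendre n k).eval (‖x‖⁻¹ * ⟪(e : E n), x⟫_ℝ) := by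
    filter_upwards [isOpen_ne.mem_nhds (ne_zero_of_mem_unit_sphere u)] with x hx
    rw [homExt, dif_pos hx, ← inner_smul_right]
    rfl
  rw [sphLaplacian, (InnerProductSpace.laplacian_congr_nhds hext).eq_of_nhds,
    laplacian_comp_norm_inv_mul_inner (norm_eq_of_mem_sphere e) (norm_eq_of_mem_sphere u)
      (fun t => (legendre n k).hasDerivAt t) ((legendre n k).derivative.hasDerivAt _),
    finrank_euclideanSpace_fin]

theorem box_zonalLegendre_zero (e : S n) : box n (zonalLegendre e 0) = zonalLegendre e 0 := by
  ext u
  change ((n : ℝ) - 1)⁻¹ * sphLaplacian (zonalLegendre e 0) u + zonalLegendre e 0 u = _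
  simp [sphLaplacian_zonalLegendre, legendre]

theorem legendre_two (n : ℕ) : legendre n 2 =
    Polynomial.C ((n : ℝ) - 1)⁻¹ * (Polynomial.C (n : ℝ) * Polynomial.X ^ 2 - 1) := by
  simp only [legendre, Nat.cast_zero, zero_add, mul_zero, mul_one, map_one]
  ring

theorem eval_legendre_two (n : ℕ) (t : ℝ) :
    (legendre n 2).eval t = ((n : ℝ) - 1)⁻¹ * (n * t ^ 2 - 1) := by
  simp only [legendre_two, Polynomial.eval_mul, Polynomial.eval_sub, Polynomial.eval_pow,
    Polynomial.eval_C, Polynomial.eval_X, Polynomial.eval_one]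

theorem derivative_legendre_two (n : ℕ) :
    (legendre n 2).derivative = Polynomial.C (2 * n / ((n : ℝ) - 1)) * Polynomial.X := by
  simp only [legendre_two, Polynomial.derivative_C_mul, Polynomial.derivative_sub,
    Polynomial.derivative_X_sq, Polynomial.derivative_one, sub_zero, ← mul_assoc, ← map_mul]
  ring_nf

/-- `P^n_2(⟨e, ·⟩)` is a spherical harmonic of degree `2`, so `Δ_S` multiplies it by `-2n`. -/
theorem box_zonalLegendre_two (hn : n ≠ 1) (e : S n) :
    box n (zonalLegendre e 2) = (-((n + 1) / ((n : ℝ) - 1))) • zonalLegendre e 2 := by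
  have hn1 : (n : ℝ) - 1 ≠ 0 := sub_ne_zero.2 (by exact_mod_cast hn)
  ext u
  change ((n : ℝ) - 1)⁻¹ * sphLaplacian (zonalLegendre e 2) u +
    (legendre n 2).eval ⟪(e : E n), (u : E n)⟫_ℝ =
      -((n + 1) / ((n : ℝ) - 1)) * (legendre n 2).eval ⟪(e : E n), (u : E n)⟫_ℝ
  rw [sphLaplacian_zonalLegendre, derivative_legendre_two, Polynomial.derivative_C_mul,
    Polynomial.derivative_X, Polynomial.eval_C_mul, Polynomial.eval_C_mul, Polynomial.eval_X,
    Polynomial.eval_one, eval_legendre_two]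
  field_simp
  ring

theorem multiplier_zero_boxDual (e : S n) (ν : TestDual n) :
    multiplier e 0 (boxDual ν) = multiplier e 0 ν :=
  congrArg ν (box_zonalLegendre_zero e)

theorem multiplier_two_boxDual (hn : n ≠ 1) (e : S n) (ν : TestDual n) :
    multiplier e 2 (boxDual ν) = -((n + 1) / ((n : ℝ) - 1)) * multiplier e 2 ν :=
  (congrArg ν (box_zonalLegendre_two hn e)).trans (map_smul ν _ _)

theorem multiplier_zero_toDual (e : S n) (f : C(S n, ℝ)) :
    multiplier e 0 (toDual f) =
      ∫ u : S n, f u ∂((volume : Measure (E n)).toSphere) := by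
  change ∫ u : S n, f u * (legendre n 0).eval ⟪(e : E n), (u : E n)⟫_ℝ ∂_ = _
  simp [legendre]

theorem multiplier_two_toDual (e : S n) (f : C(S n, ℝ)) :
    multiplier e 2 (toDual f) = ((n : ℝ) - 1)⁻¹ *
      ∫ u : S n, f u * (n * ⟪(e : E n), (u : E n)⟫_ℝ ^ 2 - 1)
        ∂((volume : Measure (E n)).toSphere) := by
  change ∫ u : S n, f u * (legendre n 2).eval ⟪(e : E n), (u : E n)⟫_ℝ ∂_ = _
  simp only [eval_legendre_two, mul_left_comm, integral_const_mul]

end BoxOperator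

section Multipliers

theorem integral_mul_const_add_mul_inner_sq {V : Type*} [NormedAddCommGroup V]
    [InnerProductSpace ℝ V] [FiniteDimensional ℝ V] [MeasurableSpace V] [BorelSpace V]
    (ν : Measure (sphere (0 : V) 1)) [IsFiniteMeasure ν] {f : V → ℝ} (hf : Continuous f) (e : V)
    (a b : ℝ) :
    ∫ u, f u * (a + b * ⟪e, (u : V)⟫_ℝ ^ 2) ∂ν =
      a * ∫ u, f u ∂ν + b * ∫ u, f u * ⟪e, (u : V)⟫_ℝ ^ 2 ∂ν := by
  have hint : ∀ g : sphere (0 : V) 1 → ℝ, Continuous g → Integrable g ν := fun g hg =>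
    hg.integrable_of_hasCompactSupport (.of_compactSpace g)
  rw [← integral_const_mul, ← integral_const_mul,
    ← integral_add (hint _ (by fun_prop)) (hint _ (by fun_prop))]
  congr! 2
  ring

variable {n : ℕ} [NeZero n] (e : S n) (L : ConvexBody (E n))

theorem multiplier_zero_boxDual_supportFn :
    multiplier e 0 (boxDual (toDual (supportFn L))) =
      (∫ u : S n, width L u ∂(volume : Measure (E n)).toSphere) / 2 := by
  have h := integral_width_mul L volume (continuous_const (y := (1 : ℝ))) fun _ => rfl
  simp only [mul_one] at h
  rw [h, mul_div_cancel_left₀ _ two_ne_zero, multiplier_zero_boxDual, multiplier_zero_toDual]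
  rfl

theorem multiplier_two_boxDual_supportFn (hn : n ≠ 1) :
    multiplier e 2 (boxDual (toDual (supportFn L))) = (n + 1) / (2 * ((n : ℝ) - 1) ^ 2) *
      (∫ u : S n, width L u ∂(volume : Measure (E n)).toSphere -
        n * ∫ u : S n, width L u * ⟪(e : E n), (u : E n)⟫_ℝ ^ 2
          ∂(volume : Measure (E n)).toSphere) := by
  have hn1 : (n : ℝ) - 1 ≠ 0 := sub_ne_zero.2 (by exact_mod_cast hn)
  have hwidth := integral_width_mul L volume (g := fun x => -1 + n * ⟪(e : E n), x⟫_ℝ ^ 2)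
    (by fun_prop) fun x => by simp only [inner_neg_right, neg_sq]
  have hsupport : ∫ u : S n, supportFn L u * (n * ⟪(e : E n), (u : E n)⟫_ℝ ^ 2 - 1)
      ∂(volume : Measure (E n)).toSphere = ∫ u : S n, supportFunction L u *
        (-1 + n * ⟪(e : E n), (u : E n)⟫_ℝ ^ 2) ∂(volume : Measure (E n)).toSphere := by
    simp only [neg_add_eq_sub]
    rfl
  rw [integral_mul_const_add_mul_inner_sq _ (continuous_seminorm (width L))] at hwidth
  rw [multiplier_two_boxDual hn, multiplier_two_toDual, hsupport,
    ← mul_div_cancel_left₀ (∫ u : S n, supportFunction L u * _ ∂_) two_ne_zero, ← hwidth]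
  field_simp
  ring

variable {e L}

theorem multiplier_zero_boxDual_supportFn_pos (hpt : (L : Set (E n)).Nontrivial) :
    0 < multiplier e 0 (boxDual (toDual (supportFn L))) := by
  obtain ⟨u, hu, hne⟩ := exists_norm_eq_one_width_ne_zero hpt
  have hcont := continuous_seminorm (width L)
  rw [multiplier_zero_boxDual_supportFn]
  exact half_pos (Continuous.integral_pos_of_hasCompactSupport_nonneg_nonzero
    (hcont.comp continuous_subtype_val) (.of_compactSpace _) (fun _ => apply_nonneg _ _)
    (x := ⟨u, by simpa using hu⟩) hne)

variable (hn : 3 ≤ n) (hL : IsAxiallySymmetric (e : E n) (· ∈ L))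
  (hpt : (L : Set (E n)).Nontrivial)
include hn hL hpt

theorem sq_mul_multiplier_two_le_and_eq_iff_isDisk :
    ((n : ℝ) - 1) ^ 2 * multiplier e 2 (boxDual (toDual (supportFn L))) ≤
        multiplier e 0 (boxDual (toDual (supportFn L))) ∧
      (((n : ℝ) - 1) ^ 2 * multiplier e 2 (boxDual (toDual (supportFn L))) =
        multiplier e 0 (boxDual (toDual (supportFn L))) ↔ IsDisk (L : Set (E n))) := by
  have hn0 : (0 : ℝ) < n := Nat.cast_pos.2 (by omega)
  have hn1 : (n : ℝ) - 1 ≠ 0 := sub_ne_zero.2 (by exact_mod_cast (by omega : n ≠ 1))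
  have hdiff : multiplier e 0 (boxDual (toDual (supportFn L))) -
      ((n : ℝ) - 1) ^ 2 * multiplier e 2 (boxDual (toDual (supportFn L))) =
        n / 2 * ∫ u : S n, width L u * ((n + 1) * ⟪(e : E n), (u : E n)⟫_ℝ ^ 2 - 1)
          ∂(volume : Measure (E n)).toSphere := by
    simp only [sub_eq_neg_add _ (1 : ℝ),
      integral_mul_const_add_mul_inner_sq _ (continuous_seminorm (width L))]
    simp only [← sub_eq_neg_add]
    rw [multiplier_zero_boxDual_supportFn, multiplier_two_boxDual_supportFn e L (by omega)]
    field_simp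
    ring
  obtain ⟨hnonneg, hzero⟩ := hL.width.integral_mul_nonneg_and_eq_zero_iff_map_axis volume
    (norm_eq_of_mem_sphere e) (by rw [finrank_euclideanSpace_fin]; omega)
  rw [finrank_euclideanSpace_fin] at hnonneg hzero
  rw [isDisk_iff_width_axis_eq_zero hn hL hpt, ← hzero, ← sub_nonneg, eq_comm, ← sub_eq_zero, hdiff,
    mul_eq_zero_iff_left (half_pos hn0).ne']
  exact ⟨mul_nonneg (half_pos hn0).le hnonneg, Iff.rfl⟩

theorem neg_le_mul_multiplier_two_and_eq_iff_isLineSegment :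
    -multiplier e 0 (boxDual (toDual (supportFn L))) ≤
        ((n : ℝ) - 1) * multiplier e 2 (boxDual (toDual (supportFn L))) ∧
      (((n : ℝ) - 1) * multiplier e 2 (boxDual (toDual (supportFn L))) =
        -multiplier e 0 (boxDual (toDual (supportFn L))) ↔ IsLineSegment (L : Set (E n))) := by
  have hn1 : (0 : ℝ) < n - 1 := sub_pos.2 (Nat.one_lt_cast.2 (by omega))
  have hc : (0 : ℝ) < n / (n - 1) := div_pos (Nat.cast_pos.2 (by omega)) hn1
  have hsum : ((n : ℝ) - 1) * multiplier e 2 (boxDual (toDual (supportFn L))) -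
      -multiplier e 0 (boxDual (toDual (supportFn L))) =
        n / (n - 1) * ∫ u : S n, width L u * (1 - (n + 1) / 2 * ⟪(e : E n), (u : E n)⟫_ℝ ^ 2)
          ∂(volume : Measure (E n)).toSphere := by
    simp only [sub_eq_add_neg (1 : ℝ), ← neg_mul,
      integral_mul_const_add_mul_inner_sq _ (continuous_seminorm (width L))]
    rw [multiplier_zero_boxDual_supportFn, multiplier_two_boxDual_supportFn e L (by omega)]
    field_simp
    ring
  obtain ⟨hnonneg, hzero⟩ := hL.width.integral_mul_nonneg_and_eq_zero_iff_map_orthogonal volume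
    (norm_eq_of_mem_sphere e) (by rw [finrank_euclideanSpace_fin]; omega)
  rw [finrank_euclideanSpace_fin] at hnonneg hzero
  rw [isLineSegment_iff_width_orthogonal_eq_zero hn hL hpt, ← hzero, ← sub_nonneg, ← sub_eq_zero,
    hsum, mul_eq_zero_iff_left hc.ne']
  exact ⟨mul_nonneg hc.le hnonneg, Iff.rfl⟩

end Multipliers

end ConvexRevolution

end

open ConvexRevolution in
theorem mainTheorem9 (n : ℕ) [NeZero n] (hn : 3 ≤ n) (e : S n) (L : ConvexBody (E n))
    (hL : IsBodyOfRevolution e L) (hpt : (L : Set (E n)).Nontrivial) :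
    0 < multiplier e 0 (boxDual (toDual (supportFn L))) ∧
    -(1 / ((n : ℝ) - 1)) ≤ multiplier e 2 (boxDual (toDual (supportFn L))) /
      multiplier e 0 (boxDual (toDual (supportFn L))) ∧
    multiplier e 2 (boxDual (toDual (supportFn L))) /
      multiplier e 0 (boxDual (toDual (supportFn L))) ≤ 1 / ((n : ℝ) - 1) ^ 2 ∧
    (multiplier e 2 (boxDual (toDual (supportFn L))) /
        multiplier e 0 (boxDual (toDual (supportFn L))) = -(1 / ((n : ℝ) - 1)) ↔
      IsLineSegment (L : Set (E n))) ∧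
    (multiplier e 2 (boxDual (toDual (supportFn L))) /
        multiplier e 0 (boxDual (toDual (supportFn L))) = 1 / ((n : ℝ) - 1) ^ 2 ↔
      IsDisk (L : Set (E n))) := by
  have hsym : IsAxiallySymmetric (e : E n) (· ∈ L) :=
    isAxiallySymmetric_mem_of_rotation_image_eq (by rwa [finrank_euclideanSpace_fin]) hL
  have hn1 : (0 : ℝ) < n - 1 := sub_pos.2 (Nat.one_lt_cast.2 (by omega))
  have hpos := multiplier_zero_boxDual_supportFn_pos (e := e) hpt
  obtain ⟨hsegment, hsegment_iff⟩ := neg_le_mul_multiplier_two_and_eq_iff_isLineSegment hn hsym hpt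
  obtain ⟨hdisk, hdisk_iff⟩ := sq_mul_multiplier_two_le_and_eq_iff_isDisk hn hsym hpt
  refine ⟨hpos, ?_, ?_, ?_, ?_⟩
  · rwa [← neg_div, div_le_div_iff₀ hn1 hpos, neg_one_mul, mul_comm _ ((n : ℝ) - 1)]
  · rwa [div_le_div_iff₀ hpos (pow_pos hn1 2), one_mul, mul_comm]
  · rw [← hsegment_iff, ← neg_div, div_eq_div_iff hpos.ne' hn1.ne', neg_one_mul, mul_comm]
  · rw [← hdisk_iff, div_eq_div_iff hpos.ne' (pow_pos hn1 2).ne', one_mul, mul_comm]
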